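/- **Problem.** An instance of Ordered $k$-Median consists of $m$ facilities $\mathcal F$ and $n$ clients $\mathcal C$ in a (pseudo)metric space with distances $c$, an integer $1\le k\le m$, and weights $w_1\ge\dots\ge w_n\ge 0$. For $\mathcal W\subseteq\mathcal F$ with $|\mathcal W|=k$ let $c_1^\to(\mathcal W)\ge\dots\ge c_n^\to(\mathcal W)$ be the sorted values $c_j(\mathcal W)=\min_{i\in\mathcal W}c_{ij}$, $j\in\mathcal C$, and let $\mathrm{cost}(\mathcal W)=\sum_{s=1}^n w_s\,c_s^\to(\mathcal W)$. Let $\mathrm{OPT}$ be the minimum of $\mathrm{cost}$ over all $k$-subsets of $\mathcal F$. Let $\bar w_1>\dots>\bar w_R$ be the distinct values of the weights. Fix a total order on the pairs in $\mathcal F\times\mathcal C$ by nondecreasing distance, ties being broken arbitrarily (if all $c_{ij}$ are distinct, this is the order by distance); all comparisons with thresholds below refer to this order. **Guesses.** A guess is a choice, for each $r=1,\dots,R$, of a pair in $\mathcal F\times\mathcal C$, whose distance is the threshold $T_r$, such that $T_1>\dots>T_R$. Put $T_0=\infty$, let $w(i,j)=\bar w_r$ if $T_r\le c_{ij}<T_{r-1}$,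 let $w(i,j)=0$ if $c_{ij}<T_R$, and define the reduced costs $c^{\mathrm r}_{ij}=c_{ij}\,w(i,j)$. A guess is *right* for an optimum solution $\mathcal W$ if, for some assignment of each client to a closest facility of $\mathcal W$, $T_r$ is the smallest of the assigned pairs that are multiplied by a weight of value $\bar w_r$ when the assigned pairs are sorted decreasingly. **LP.** Minimize $\sum_{i,j}c^{\mathrm r}_{ij}x_{ij}$ subject to $x_{ij}\le y_i$, $\sum_i x_{ij}=1$, $\sum_i y_i=k$, $0\le x_{ij},y_i\le 1$. After deleting facilities and splitting facilities into co-located copies, an optimum solution $(x,y)$ is taken in canonical form: $y_i>0$, $x_{ij}\in\{0,y_i\}$, and $x$ minimizes $\sum_{i,j} c_{ij}x_{ij}$ for fixed $y$. **Rounding.** Let $c_{\mathrm{av}}(j)=\sum_i c_{ij}x_{ij}$. (1) Oblivious clustering: starting with $\mathcal C''=\mathcal C$ and $\mathcal C'=\emptyset$, repeatedly move a $j\in\mathcal C''$ with smallest $c_{\mathrm{av}}(j)$ to $\mathcal C'$ and delete from $\mathcal C''$ all $j'$ with $c_{jj'}\le 4c_{\mathrm{av}}(j')$, until $\mathcal C''=\emptyset$.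 (2) Bundling: for $j\in\mathcal C'$ let $R_j=\frac12\min_{j'\in\mathcal C',\,j'\ne j}c_{jj'}$ ($\infty$ if $\mathcal C'=\{j\}$) and $\mathcal U_j=\{i: c_{ij}<R_j,\ x_{ij}>0\}$. (3) Matching: repeatedly match a closest pair of unmatched elements of $\mathcal C'$ until at most one is left. (4) Sampling: open a random set of copies of facilities such that each copy $i$ is open with probability exactly $y_i$, each $\mathcal U_j$ ($j\in\mathcal C'$) contains an open copy with probability exactly $\sum_{i\in\mathcal U_j}y_i$, and surely $\mathcal U_j\cup\mathcal U_{j'}$ contains an open copy for each matched pair $(j,j')$ and at most $k$ copies are open. Output the corresponding facilities, completed arbitrarily to exactly $k$ facilities. **Algorithm.** For every guess compute a canonical optimum LP solution, call the rounding algorithm once on it (independently for different guesses), and return the cheapest of the solutions found. **Statement.** The algorithm can be implemented: canonical optimum LP solutions exist for all guesses, and on every canonical feasible fractional solution the rounding algorithm, including its sampling phase, can be carried out. Every optimum solution has a right guess. For every implementation (every choice of the LP solutions, of the tie-breaking, of the sampling law and of the completion): 1. for every right guess, the output $A$ of the rounding algorithm for this single guess satisfies $\mathbb E[\mathrm{cost}(A)]\le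 38\cdot\mathrm{OPT}$; 2. the algorithm always returns a set of exactly $k$ facilities and makes at most $(nm)^R$ calls of the rounding algorithm; 3. the set $A$ returned by the algorithm satisfies $\mathbb E[\mathrm{cost}(A)]\le 38\cdot\mathrm{OPT}$. -/

import Mathlib

noncomputable section

/-- An instance of (metric) Ordered `k`-Median: `m` facilities and `n` clients, given as points of a
common (pseudo)metric space, the number `k` of facilities to open, and a non-increasing vector of
nonnegative weights (position `0` is the largest weight). -/
structure OrderedKMedian (X : Type*) [PseudoMetricSpace X] (m n : ℕ) where
  facility : Fin m → X
  client : Fin n → X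
  k : ℕ
  one_le_k : 1 ≤ k
  k_le_m : k ≤ m
  w : Fin n → ℝ
  w_antitone : Antitone w
  w_nonneg : ∀ s, 0 ≤ w s

namespace OrderedKMedian

/-! ### Expectations and probabilities for laws on finite types -/

/-- Expectation of a real function under a probability law on a finite type. -/
def expect {α : Type*} [Fintype α] (μ : PMF α) (f : α → ℝ) : ℝ :=
  ∑ a, (μ a).toReal * f a

open Classical in
/-- Probability of an event under a probability law on a finite type. -/
def prob {α : Type*} [Fintype α] (μ : PMF α) (P : α → Prop) : ℝ :=
  expect μ (fun a => if P a then 1 else 0)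

variable {X : Type*} [PseudoMetricSpace X] {m n : ℕ} (I : OrderedKMedian X m n)

/-! ### The problem -/

/-- The distance `c i j` between facility `i` and client `j`. -/
def c (i : Fin m) (j : Fin n) : ℝ := dist (I.facility i) (I.client j)

/-- The distance between two clients. -/
def cc (j j' : Fin n) : ℝ := dist (I.client j) (I.client j')

/-- The connection cost of client `j`: its distance to the closest facility of `W`
(for nonempty `W`; the value for empty `W` is never used). -/
def connCost (W : Finset (Fin m)) (j : Fin n) : ℝ :=
  if h : W.Nonempty then W.inf' h (fun i => I.c i j) else 0

/-- The connection costs of all clients, sorted in non-increasing order. -/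
def sortedCost (W : Finset (Fin m)) (s : Fin n) : ℝ :=
  I.connCost W (Tuple.sort (fun j => -I.connCost W j) s)

theorem sortedCost_antitone (W : Finset (Fin m)) : Antitone (I.sortedCost W) := by
  intro s t hst
  have h := Tuple.monotone_sort (fun j => -I.connCost W j) hst
  simpa [sortedCost] using h

/-- The objective: the `s`-th largest connection cost is multiplied by the `s`-th weight. -/
def cost (W : Finset (Fin m)) : ℝ := ∑ s, I.w s * I.sortedCost W s

theorem solutions_nonempty :
    (Finset.powersetCard I.k (Finset.univ : Finset (Fin m))).Nonempty :=
  Finset.powersetCard_nonempty.2 (by simpa using I.k_le_m)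

/-- The optimum value: the minimum of the objective over all sets of exactly `k` facilities. -/
def opt : ℝ := (Finset.powersetCard I.k Finset.univ).inf' I.solutions_nonempty I.cost

/-- `W` is an optimum solution. -/
def IsOptimum (W : Finset (Fin m)) : Prop :=
  W.card = I.k ∧ ∀ W' : Finset (Fin m), W'.card = I.k → I.cost W ≤ I.cost W'

/-! ### Distinct weights, guesses and reduced costs -/

/-- The set of values of the weight vector. -/
def weightValues : Finset ℝ := Finset.univ.image I.w

/-- The number `R` of distinct weights. -/
def R : ℕ := I.weightValues.card

/-- The distinct weights in decreasing order. -/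
def wbar (r : Fin I.R) : ℝ := I.weightValues.orderEmbOfFin rfl (Fin.rev r)

/-- A ranking of the facility-client pairs that lists them by increasing distance, ties being broken
in an arbitrary fixed way. It plays the role of an infinitesimal perturbation that makes all
distances distinct. -/
def IsRanking (rank : Fin m × Fin n → ℕ) : Prop :=
  Function.Injective rank ∧ ∀ p q, I.c p.1 p.2 < I.c q.1 q.2 → rank p < rank q

/-- If the distances are pairwise distinct, then comparing ranks is comparing distances. -/
theorem IsRanking.le_iff {I : OrderedKMedian X m n} {rank : Fin m × Fin n → ℕ}
    (h : I.IsRanking rank)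
    (hd : Function.Injective (fun p : Fin m × Fin n => I.c p.1 p.2)) (p q : Fin m × Fin n) :
    rank p ≤ rank q ↔ I.c p.1 p.2 ≤ I.c q.1 q.2 := by
  constructor
  · intro hpq
    by_contra hc
    exact absurd (h.2 q p (not_le.1 hc)) (not_lt.2 hpq)
  · intro hpq
    rcases hpq.lt_or_eq with hlt | heq
    · exact (h.2 p q hlt).le
    · exact (congrArg rank (hd heq)).le

/-- A guess: for each distinct weight, the facility-client pair whose distance is the threshold
`T r`. There are `(m * n) ^ R` guesses. -/
abbrev Guess : Type := Fin I.R → Fin m × Fin n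

/-- Thresholds have to be strictly decreasing. -/
def IsDecreasing (rank : Fin m × Fin n → ℕ) (g : I.Guess) : Prop :=
  ∀ r r', r < r' → rank (g r') < rank (g r)

/-- The weight `w(i,j)` of a pair under a guess: it is `wbar r` if `T r ≤ c i j < T (r - 1)` (there is
no upper condition for the first `r`), comparisons being made by `rank`, and it is `0` if `c i j` is
below the last threshold. At most one summand is nonzero. -/
def pairWeight (rank : Fin m × Fin n → ℕ) (g : I.Guess) (i : Fin m) (j : Fin n) : ℝ :=
  ∑ r, if rank (g r) ≤ rank (i, j) ∧ ∀ r' < r, rank (i, j) < rank (g r') then I.wbar r else 0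

/-- The reduced cost of a guess. -/
def reducedCost (rank : Fin m × Fin n → ℕ) (g : I.Guess) (i : Fin m) (j : Fin n) : ℝ :=
  I.c i j * I.pairWeight rank g i j

/-- `g` consists of the right thresholds for the solution `W`: the clients are listed as `σ 0, σ 1, …`
and each client `j` is served by a closest facility `a j` of `W`, so that the serving pairs come in
decreasing order and the pair in position `s` is multiplied by `w s`; then `g r` is the smallest of
the pairs that are multiplied by a weight of value `wbar r`. -/
def IsRightGuess (rank : Fin m × Fin n → ℕ) (W : Finset (Fin m)) (g : I.Guess) : Prop :=
  ∃ (σ : Equiv.Perm (Fin n)) (a : Fin n → Fin m),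
    (∀ j, a j ∈ W ∧ I.c (a j) j = I.connCost W j) ∧
    (∀ s t, s < t → rank (a (σ t), σ t) < rank (a (σ s), σ s)) ∧
    ∀ r, ∃ s, g r = (a (σ s), σ s) ∧ I.w s = I.wbar r ∧ ∀ t, I.w t = I.wbar r → t ≤ s

/-! ### The linear program -/

/-- The feasible solutions of the `k`-median linear program on a finite set `ι` of facilities. -/
structure LPFeasible {ι : Type*} [Fintype ι] (k n : ℕ) (x : ι → Fin n → ℝ) (y : ι → ℝ) : Prop where
  x_le_y : ∀ i j, x i j ≤ y i
  served : ∀ j, ∑ i, x i j = 1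
  opened : ∑ i, y i = k
  x_nonneg : ∀ i j, 0 ≤ x i j
  x_le_one : ∀ i j, x i j ≤ 1
  y_nonneg : ∀ i, 0 ≤ y i
  y_le_one : ∀ i, y i ≤ 1

/-- The objective of the linear program with cost vector `cr`. -/
def lpValue {ι : Type*} [Fintype ι] (cr : ι → Fin n → ℝ) (x : ι → Fin n → ℝ) : ℝ :=
  ∑ i, ∑ j, cr i j * x i j

/-- Optimum solutions of the linear program `LP(cr)`. -/
def LPOptimal (cr : Fin m → Fin n → ℝ) (x : Fin m → Fin n → ℝ) (y : Fin m → ℝ) : Prop :=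
  LPFeasible I.k n x y ∧
    ∀ (x' : Fin m → Fin n → ℝ) (y' : Fin m → ℝ), LPFeasible I.k n x' y' → lpValue cr x ≤ lpValue cr x'

end OrderedKMedian

/-- A fractional solution after removing and duplicating facilities: there are `N` (co-located) copies
of facilities, copy `a` being a copy of the facility `origin a`. -/
structure SplitSolution (m n : ℕ) where
  N : ℕ
  origin : Fin N → Fin m
  x : Fin N → Fin n → ℝ
  y : Fin N → ℝ

namespace SplitSolution

variable {m n : ℕ}

/-- The solution on the original facilities: sum over all copies of a facility. -/
def totalX (S : SplitSolution m n) (i : Fin m) (j : Fin n) : ℝ :=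
  ∑ a with S.origin a = i, S.x a j

/-- The opening vector on the original facilities. -/
def totalY (S : SplitSolution m n) (i : Fin m) : ℝ :=
  ∑ a with S.origin a = i, S.y a

end SplitSolution

namespace OrderedKMedian

variable {X : Type*} [PseudoMetricSpace X] {m n : ℕ} (I : OrderedKMedian X m n)

/-- The input of the rounding algorithm: a feasible fractional solution in which every (copy of a)
facility is opened to a positive extent, serves each client either not at all or to the full extent
to which it is opened, and in which the assignment `x` is distance-optimal, i.e. minimizes the total
distance (with respect to `c`) among all feasible assignments for the same `y`. -/
structure IsCanonical (S : SplitSolution m n) : Prop where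
  feasible : LPFeasible I.k n S.x S.y
  y_pos : ∀ a, 0 < S.y a
  x_eq : ∀ a j, S.x a j = 0 ∨ S.x a j = S.y a
  distance_optimal : ∀ x', LPFeasible I.k n x' S.y →
    lpValue (fun a j => I.c (S.origin a) j) S.x ≤ lpValue (fun a j => I.c (S.origin a) j) x'

/-- A solver for the linear programs with reduced costs: for each guess with decreasing thresholds it
returns an optimum solution of the linear program, in canonical form. -/
def IsLPSolver (rank : Fin m × Fin n → ℕ) (solve : I.Guess → SplitSolution m n) : Prop :=
  ∀ g, I.IsDecreasing rank g →
    I.IsCanonical (solve g) ∧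
      I.LPOptimal (I.reducedCost rank g) (solve g).totalX (solve g).totalY

/-! ### The rounding algorithm with oblivious clustering -/

/-- The average connection cost of a client in a fractional solution. -/
def cav (S : SplitSolution m n) (j : Fin n) : ℝ := ∑ a, S.x a j * I.c (S.origin a) j

/-- Clustering phase. `ObliviousClustering S Q D`: the loop, started with the set `Q` of remaining
clients, can return the set `D` of cluster centers. In each round a client `j` of smallest average
cost is made a center, and it is removed together with all `j'` at distance at most `4 * cav j'`. -/
inductive ObliviousClustering (S : SplitSolution m n) : Finset (Fin n) → Finset (Fin n) → Prop
  | done : ObliviousClustering S ∅ ∅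
  | step (Q D : Finset (Fin n)) (j : Fin n) (hj : j ∈ Q)
      (hmin : ∀ j' ∈ Q, I.cav S j ≤ I.cav S j')
      (hrest : ObliviousClustering S
        ((Q.erase j).filter (fun j' => ¬ I.cc j j' ≤ 4 * I.cav S j')) D) :
      ObliviousClustering S Q (insert j D)

/-- Bundling phase. The bundle of the center `j`: all copies of facilities that serve `j` and have
distance less than `R_j` to `j`, where `R_j` is half the distance to the closest other center
(`R_j = ∞` if `j` is the only center). -/
def bundle (S : SplitSolution m n) (D : Finset (Fin n)) (j : Fin n) : Finset (Fin S.N) :=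
  {a | (∀ j' ∈ D, j' ≠ j → I.c (S.origin a) j < I.cc j j' / 2) ∧ 0 < S.x a j}

/-- Matching phase. `GreedyMatching Q M`: the loop, started with the set `Q` of unmatched centers, can
return the list `M` of pairs. As long as there are two unmatched centers, a closest pair of unmatched
centers is matched. -/
inductive GreedyMatching : Finset (Fin n) → List (Fin n × Fin n) → Prop
  | done (Q : Finset (Fin n)) (hQ : Q.card ≤ 1) : GreedyMatching Q []
  | step (Q : Finset (Fin n)) (M : List (Fin n × Fin n)) (j j' : Fin n)
      (hj : j ∈ Q) (hj' : j' ∈ Q) (hne : j ≠ j')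
      (hmin : ∀ i ∈ Q, ∀ i' ∈ Q, i ≠ i' → I.cc j j' ≤ I.cc i i')
      (hrest : GreedyMatching ((Q.erase j).erase j') M) :
      GreedyMatching Q ((j, j') :: M)

/-- Sampling phase. `μ` is a possible law of the random set of (copies of) facilities opened by the
dependent rounding procedure for the centers `D` and the matching `M`. -/
structure IsDependentRounding (S : SplitSolution m n) (D : Finset (Fin n))
    (M : List (Fin n × Fin n)) (μ : PMF (Finset (Fin S.N))) : Prop where
  facility_prob : ∀ a, prob μ (fun A => a ∈ A) = S.y a
  bundle_prob : ∀ j ∈ D,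
    prob μ (fun A => (A ∩ I.bundle S D j).Nonempty) = ∑ a ∈ I.bundle S D j, S.y a
  pair_opened : ∀ A ∈ μ.support, ∀ p ∈ M,
    (A ∩ (I.bundle S D p.1 ∪ I.bundle S D p.2)).Nonempty
  card_le : ∀ A ∈ μ.support, A.card ≤ I.k

/-- `ν` is a possible law of the output of the rounding algorithm with oblivious clustering on the
input `S`: cluster, bundle, match, sample, and open the facilities whose copies were sampled. If these
are fewer than `k` distinct facilities, arbitrary further ones are added (`pad`). -/
def IsRoundingOutput (S : SplitSolution m n) (ν : PMF (Finset (Fin m))) : Prop :=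
  ∃ (D : Finset (Fin n)) (M : List (Fin n × Fin n)) (μ : PMF (Finset (Fin S.N)))
    (pad : Finset (Fin m) → Finset (Fin m)),
    I.ObliviousClustering S Finset.univ D ∧
    I.GreedyMatching D M ∧
    I.IsDependentRounding S D M μ ∧
    (∀ B : Finset (Fin m), B.card ≤ I.k → B ⊆ pad B ∧ (pad B).card = I.k) ∧
    ν = μ.map (fun A => pad (A.image S.origin))

/-- `round` is an implementation of the rounding algorithm: on each canonical fractional solution its
random output follows the algorithm, for some way of breaking ties. -/
def IsRoundingAlgorithm (round : SplitSolution m n → PMF (Finset (Fin m))) : Prop :=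
  ∀ S, I.IsCanonical S → I.IsRoundingOutput S (round S)

/-! ### The complete algorithm -/

/-- The cheaper one of a solution and the best solution found elsewhere (if any). -/
def cheaper (A : Finset (Fin m)) : Option (Finset (Fin m)) → Finset (Fin m)
  | none => A
  | some B => if I.cost A ≤ I.cost B then A else B

/-- Try all guesses of a list: for each guess solve the linear program, call the rounding algorithm
once (with fresh randomness), and keep the cheapest solution found. The result is the joint law of the
returned solution (`none` for the empty list) and the number of calls of the rounding algorithm. -/
def search (solve : I.Guess → SplitSolution m n) (round : SplitSolution m n → PMF (Finset (Fin m))) :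
    List I.Guess → PMF (Option (Finset (Fin m)) × ℕ)
  | [] => PMF.pure (none, 0)
  | g :: gs => (round (solve g)).bind fun A =>
      (search solve round gs).map fun s => (some (I.cheaper A s.1), s.2 + 1)

open Classical in
/-- The complete algorithm: try all guesses with decreasing thresholds. -/
def algorithm (rank : Fin m × Fin n → ℕ) (solve : I.Guess → SplitSolution m n)
    (round : SplitSolution m n → PMF (Finset (Fin m))) : PMF (Option (Finset (Fin m)) × ℕ) :=
  I.search solve round
    ((Finset.univ : Finset I.Guess).filter (fun g => I.IsDecreasing rank g)).toList

end OrderedKMedian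

end

noncomputable section

namespace OrderedKMedian

/-! ### Expectations under finite laws -/

section Expectation

variable {α β : Type*} [Fintype α] [Fintype β]

/-! Let δ_r be the difference of consecutive distinct weights (for the last one, the smallest weight
itself). Every weight `w s` is the sum of the δ_r with `wbar r ≤ w s`, so the objective is Σ_r δ_r
times the sum of the ℓ_r largest connection costs, where ℓ_r counts the positions of weight at least
`wbar r`. For every τ the ℓ_r largest costs sum to at most ℓ_r τ + Σ_j max(c_j − τ, 0)
(`cost_le_sum_levels`); the choice is τ = 29 T_r.

For a right guess both terms are charged to the optimum. T_r is at most each of the ℓ_r largest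
costs of the optimum solution, hence Σ_r δ_r ℓ_r T_r ≤ OPT (`IsRightGuess.sum_threshold_le`). The
reduced LP is a relaxation (`IsRightGuess.lpValue_le`), and its value splits over the levels: level
r contributes δ_r times the part of the average costs that comes from pairs not below T_r
(`lpValue_reducedCost_eq`). What remains concerns one client j and one threshold T: E max(c_j(A) −
29T, 0) is at most 9 times the part of the average cost of j due to pairs beyond T
(`IsRoundingOutput.expect_connCost_le`). The rounding does not see the thresholds, so this holds on
all levels at once, and 29 + 9 = 38.

For the client bound, j has a center j' within 4 cav(j) and with cav(j') ≤ cav(j). Either a copy in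
the bundle of j' is open, or some copy within 5R of j' is, where R is the bundle radius;
`sum_excess_le` bounds the resulting expectation by cases on the size of R.

Sampling is possible because bundles have mass between 1/2 and 1: systematic sampling along a line
on which matched bundles are adjacent has all required properties. The complete algorithm is
pointwise at least as good as its run on a right guess, which is among the guesses tried. -/

theorem sum_toReal (μ : PMF α) : ∑ a, (μ a).toReal = 1 := by
  have h := μ.tsum_coe
  rw [tsum_fintype] at h
  rw [← ENNReal.toReal_sum (fun a _ => μ.apply_ne_top a), h, ENNReal.toReal_one]

theorem expect_const (μ : PMF α) (r : ℝ) : expect μ (fun _ => r) = r := by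
  simp [expect, ← Finset.sum_mul, sum_toReal]

theorem expect_add (μ : PMF α) (f g : α → ℝ) :
    expect μ (fun a => f a + g a) = expect μ f + expect μ g := by
  simp [expect, mul_add, Finset.sum_add_distrib]

theorem expect_mul_left (μ : PMF α) (r : ℝ) (f : α → ℝ) :
    expect μ (fun a => r * f a) = r * expect μ f := by
  simp only [expect, Finset.mul_sum]
  exact Finset.sum_congr rfl fun a _ => by ring

theorem expect_sum {ι : Type*} (s : Finset ι) (μ : PMF α) (f : ι → α → ℝ) :
    expect μ (fun a => ∑ i ∈ s, f i a) = ∑ i ∈ s, expect μ (f i) := by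
  simp only [expect, Finset.mul_sum]
  exact Finset.sum_comm

theorem expect_mono (μ : PMF α) {f g : α → ℝ} (h : ∀ a ∈ μ.support, f a ≤ g a) :
    expect μ f ≤ expect μ g := by
  refine Finset.sum_le_sum fun a _ => ?_
  by_cases ha : a ∈ μ.support
  · exact mul_le_mul_of_nonneg_left (h a ha) ENNReal.toReal_nonneg
  · rw [PMF.mem_support_iff, not_not] at ha
    simp [ha]

theorem expect_congr (μ : PMF α) {f g : α → ℝ} (h : ∀ a ∈ μ.support, f a = g a) :
    expect μ f = expect μ g :=
  le_antisymm (expect_mono μ fun a ha => (h a ha).le) (expect_mono μ fun a ha => (h a ha).ge)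

theorem expect_bind (μ : PMF α) (κ : α → PMF β) (f : β → ℝ) :
    expect (μ.bind κ) f = expect μ (fun a => expect (κ a) f) := by
  have h : ∀ b, ((μ.bind κ) b).toReal = ∑ a, (μ a).toReal * (κ a b).toReal := fun b => by
    rw [PMF.bind_apply, tsum_fintype, ENNReal.toReal_sum
      (fun a _ => ENNReal.mul_ne_top (μ.apply_ne_top a) ((κ a).apply_ne_top b))]
    simp
  simp only [expect, h, Finset.sum_mul, Finset.mul_sum, mul_assoc]
  exact Finset.sum_comm

theorem expect_pure (a : α) (f : α → ℝ) : expect (PMF.pure a) f = f a := by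
  classical
  simp [expect, PMF.pure_apply, apply_ite ENNReal.toReal]

theorem expect_map (μ : PMF α) (φ : α → β) (f : β → ℝ) :
    expect (μ.map φ) f = expect μ (fun a => f (φ a)) := by
  rw [← PMF.bind_pure_comp, expect_bind]
  simp [expect_pure]

/-- If `B` is hit at most once, the indicator of a hit equals the number of hits, and expectation is
linear. -/
theorem prob_nonempty_inter {N : ℕ} (μ : PMF (Finset (Fin N))) (B : Finset (Fin N))
    (h : ∀ A ∈ μ.support, (A ∩ B).card ≤ 1) :
    prob μ (fun A => (A ∩ B).Nonempty) = ∑ a ∈ B, prob μ (fun A => a ∈ A) := by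
  classical
  simp only [prob]
  rw [← expect_sum]
  refine expect_congr μ fun A hA => ?_
  have h1 : (∑ a ∈ B, if a ∈ A then (1 : ℝ) else 0) = ((A ∩ B).card : ℝ) := by
    rw [Finset.sum_boole, Finset.filter_mem_eq_inter, Finset.inter_comm]
  have h2 := h A hA
  refine Eq.trans ?_ (h1.symm.trans (Finset.sum_congr rfl fun a _ => by congr))
  split_ifs with hne
  · have := hne.card_pos
    have : (A ∩ B).card = 1 := by omega
    simp [this]
  · rw [Finset.not_nonempty_iff_eq_empty] at hne
    simp [hne]

end Expectation

/-! ### Systematic sampling -/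

section SystematicSampling

open MeasureTheory

theorem intervalIntegrable_floor_sub (t a b : ℝ) :
    IntervalIntegrable (fun θ : ℝ => ((⌊t - θ⌋ : ℤ) : ℝ)) volume a b := by
  refine AntitoneOn.intervalIntegrable fun θ _ θ' _ h => ?_
  exact_mod_cast Int.floor_le_floor (by linarith)

theorem integral_fract_sub (t : ℝ) :
    ∫ θ in (0 : ℝ)..1, Int.fract (t - θ) = ∫ θ in (0 : ℝ)..1, Int.fract θ := by
  have hp : Function.Periodic (Int.fract : ℝ → ℝ) 1 := Int.fract_periodic ℝ
  rw [intervalIntegral.integral_comp_sub_left (fun θ => Int.fract θ) t]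
  have := hp.intervalIntegral_add_eq (t - 1) 0
  simpa using this

/-- A randomly shifted integer grid has on average t − s points in (s, t]. Writing ⌊u⌋ as u minus
its fractional part, the fractional parts cancel by periodicity. -/
theorem integral_floor_sub_sub_floor_sub (s t : ℝ) :
    ∫ θ in (0 : ℝ)..1, (((⌊t - θ⌋ : ℤ) : ℝ) - ((⌊s - θ⌋ : ℤ) : ℝ)) = t - s := by
  have hid : ∀ u : ℝ, IntervalIntegrable (fun θ : ℝ => u - θ) volume 0 1 := fun u =>
    (continuous_const.sub continuous_id).intervalIntegrable _ _
  have hf : ∀ u : ℝ, IntervalIntegrable (fun θ : ℝ => Int.fract (u - θ)) volume 0 1 := fun u =>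
    (hid u).sub (intervalIntegrable_floor_sub u 0 1)
  have h : ∀ θ : ℝ, ((⌊t - θ⌋ : ℤ) : ℝ) - ((⌊s - θ⌋ : ℤ) : ℝ) =
      (t - s) - (Int.fract (t - θ) - Int.fract (s - θ)) := fun θ => by
    rw [Int.fract, Int.fract]; ring
  simp only [h]
  rw [intervalIntegral.integral_sub (by simp) ((hf t).sub (hf s)),
    intervalIntegral.integral_sub (hf t) (hf s), integral_fract_sub, integral_fract_sub]
  simp

/-- A random finite set driven by a uniform real number in `(0, 1]`. -/
theorem exists_pmf_expect_eq_integral {α : Type*} [Fintype α] (A : ℝ → α)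
    (hA : ∀ a, MeasurableSet {θ | A θ = a}) :
    ∃ μ : PMF α, (∀ f : α → ℝ, expect μ f = ∫ θ in (0 : ℝ)..1, f (A θ)) ∧
      ∀ a ∈ μ.support, ∃ θ, A θ = a := by
  let _ : MeasurableSpace α := ⊤
  have : MeasurableSingletonClass α := ⟨fun _ => trivial⟩
  have hm : Measurable A := measurable_to_countable' fun a => hA a
  let P : Measure ℝ := volume.restrict (Set.Ioc 0 1)
  have : IsProbabilityMeasure P := ⟨by simp [P]⟩
  have : IsProbabilityMeasure (P.map A) := Measure.isProbabilityMeasure_map hm.aemeasurable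
  refine ⟨(P.map A).toPMF, fun f => ?_, fun a ha => ?_⟩
  · have h1 := PMF.integral_eq_sum (P.map A).toPMF f
    rw [Measure.toPMF_toMeasure, integral_map hm.aemeasurable
      (measurable_of_finite f).aestronglyMeasurable] at h1
    rw [intervalIntegral.integral_of_le zero_le_one]
    simpa [expect] using h1.symm
  · rw [PMF.mem_support_iff, Measure.toPMF_apply,
      Measure.map_apply hm (measurableSet_singleton a)] at ha
    obtain ⟨θ, hθ⟩ := nonempty_of_measure_ne_zero ha
    exact ⟨θ, hθ⟩

variable {N : ℕ}

/-- Number of selected points among those of key less than `t`. -/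
theorem card_systematic (y : Fin N → ℝ) (hy0 : ∀ a, 0 ≤ y a) (hy1 : ∀ a, y a ≤ 1)
    (key : Fin N → ℕ) (hkey : Function.Injective key) (θ : ℝ) (t : ℕ) :
    ((((Finset.univ.filter fun a => ⌊(∑ b with key b < key a, y b) - θ⌋ <
        ⌊(∑ b with key b < key a, y b) + y a - θ⌋).filter fun a => key a < t).card : ℕ) : ℤ) =
      ⌊(∑ b with key b < t, y b) - θ⌋ - ⌊-θ⌋ := by
  induction t with
  | zero => simp
  | succ t ih =>
    by_cases h : ∃ a, key a = t
    · obtain ⟨a, rfl⟩ := h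
      have e1 : ∀ s : Finset (Fin N), (s.filter fun b => key b < key a + 1) =
          (s.filter fun b => key b < key a) ∪ s.filter (fun b => b = a) := fun s => by
        ext b
        simp only [Finset.mem_filter, Finset.mem_union, Nat.lt_succ_iff_lt_or_eq, hkey.eq_iff]
        tauto
      have d1 : ∀ s : Finset (Fin N), Disjoint (s.filter fun b => key b < key a)
          (s.filter (fun b => b = a)) := fun s => by
        rw [Finset.disjoint_filter]
        rintro b _ hb rfl
        exact lt_irrefl _ hb
      rw [e1, e1, Finset.card_union_of_disjoint (d1 _), Finset.sum_union (d1 _)]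
      push_cast
      rw [ih, Finset.filter_eq' Finset.univ a, Finset.filter_eq']
      simp only [Finset.mem_filter, Finset.mem_univ, true_and, if_true, Finset.sum_singleton]
      have h2 : ⌊(∑ b with key b < key a, y b) - θ⌋ ≤ ⌊(∑ b with key b < key a, y b) + y a - θ⌋ :=
        Int.floor_le_floor (by linarith [hy0 a])
      have h3 : ⌊(∑ b with key b < key a, y b) + y a - θ⌋ ≤
          ⌊(∑ b with key b < key a, y b) - θ⌋ + 1 := by
        rw [← Int.floor_add_one]
        exact Int.floor_le_floor (by linarith [hy1 a])
      split_ifs with h4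
      · simp only [Finset.card_singleton, Nat.cast_one]
        omega
      · simp only [Finset.card_empty, Nat.cast_zero]
        omega
    · have e1 : ∀ s : Finset (Fin N), (s.filter fun b => key b < t + 1) =
          (s.filter fun b => key b < t) := fun s => by
        refine Finset.filter_congr fun b _ => ?_
        rw [Nat.lt_succ_iff_lt_or_eq]
        exact or_iff_left fun hb => h ⟨b, hb⟩
      rw [e1, e1, ih]

/-- Systematic sampling: marginals `y`, a fixed number of chosen points, and the number of chosen
points in each block of consecutive colors is the sum of the marginals, rounded up or down. -/
theorem exists_systematic_sampling (y : Fin N → ℝ) (hy0 : ∀ a, 0 ≤ y a) (hy1 : ∀ a, y a ≤ 1)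
    (k : ℕ) (hk : ∑ a, y a = k) (color : Fin N → ℕ) :
    ∃ μ : PMF (Finset (Fin N)),
      (∀ a, prob μ (fun A => a ∈ A) = y a) ∧
      (∀ A ∈ μ.support, A.card ≤ k) ∧
      (∀ A ∈ μ.support, ∀ l h, l ≤ h → 1 ≤ ∑ a with l ≤ color a ∧ color a < h, y a →
        (A ∩ Finset.univ.filter fun a => l ≤ color a ∧ color a < h).Nonempty) ∧
      (∀ A ∈ μ.support, ∀ l h, l ≤ h → ∑ a with l ≤ color a ∧ color a < h, y a ≤ 1 →
        (A ∩ Finset.univ.filter fun a => l ≤ color a ∧ color a < h).card ≤ 1) := by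
  classical
  -- An injective refinement of the order by color: thresholds `t * N` for `key` are thresholds `t`
  -- for `color`.
  set key : Fin N → ℕ := fun a => color a * N + a with hkeydef
  have hlt : ∀ a t, key a < t * N ↔ color a < t := fun a t => by
    have ha := a.isLt
    constructor
    · intro h
      by_contra hc
      have := Nat.mul_le_mul_right N (not_lt.1 hc)
      simp only [hkeydef] at h
      omega
    · intro h
      have := Nat.mul_le_mul_right N (Nat.succ_le_of_lt h)
      rw [Nat.succ_mul] at this
      simp only [hkeydef]
      omega
  have hkey : Function.Injective key := fun a b h => by
    have h1 : key a % N = a := by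
      simp only [hkeydef]
      rw [Nat.mul_add_mod', Nat.mod_eq_of_lt a.isLt]
    have h2 : key b % N = b := by
      simp only [hkeydef]
      rw [Nat.mul_add_mod', Nat.mod_eq_of_lt b.isLt]
    exact Fin.ext (by rw [← h1, ← h2, h])
  set s : Fin N → ℝ := fun a => ∑ b with key b < key a, y b with hs
  -- The intervals (s a, s a + y a] are laid end to end in the order of `key`; a point is chosen iff
  -- its interval contains a point of the grid θ + ℤ.
  set A : ℝ → Finset (Fin N) := fun θ =>
    Finset.univ.filter fun a => ⌊s a - θ⌋ < ⌊s a + y a - θ⌋ with hA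
  have hcount : ∀ θ t, (((A θ).filter fun a => color a < t).card : ℤ) =
      ⌊(∑ b with color b < t, y b) - θ⌋ - ⌊-θ⌋ := fun θ t => by
    have := card_systematic y hy0 hy1 key hkey θ (t * N)
    simpa only [hlt] using this
  have hblock : ∀ θ l h, l ≤ h →
      ((A θ ∩ Finset.univ.filter fun a => l ≤ color a ∧ color a < h).card : ℤ) =
      ⌊(∑ b with color b < l, y b) + (∑ a with l ≤ color a ∧ color a < h, y a) - θ⌋ -
        ⌊(∑ b with color b < l, y b) - θ⌋ := fun θ l h hlh => by
    have e1 : ∀ s : Finset (Fin N), (s.filter fun b => color b < h) =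
        (s.filter fun b => color b < l) ∪ s.filter (fun a => l ≤ color a ∧ color a < h) := fun s => by
      ext b
      simp only [Finset.mem_filter, Finset.mem_union]
      constructor
      · rintro ⟨h1, h2⟩
        rcases lt_or_ge (color b) l with h3 | h3
        · exact Or.inl ⟨h1, h3⟩
        · exact Or.inr ⟨h1, h3, h2⟩
      · rintro (⟨h1, h2⟩ | ⟨h1, _, h2⟩)
        · exact ⟨h1, h2.trans_le hlh⟩
        · exact ⟨h1, h2⟩
    have d1 : ∀ s : Finset (Fin N), Disjoint (s.filter fun b => color b < l)
        (s.filter (fun a => l ≤ color a ∧ color a < h)) := fun s => by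
      rw [Finset.disjoint_filter]
      intro b _ hb hc
      omega
    have h1 := hcount θ h
    rw [e1, e1, Finset.card_union_of_disjoint (d1 _), Finset.sum_union (d1 _)] at h1
    push_cast at h1
    rw [hcount θ l] at h1
    have h2 : A θ ∩ Finset.univ.filter (fun a => l ≤ color a ∧ color a < h) =
        (A θ).filter fun a => l ≤ color a ∧ color a < h := by
      ext b; simp
    rw [h2]
    omega
  have hmeas : ∀ B, MeasurableSet {θ | A θ = B} := fun B => by
    have : {θ | A θ = B} = ⋂ a, {θ | a ∈ A θ ↔ a ∈ B} := by
      ext θ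
      simp [Finset.ext_iff]
    rw [this]
    refine MeasurableSet.iInter fun a => ?_
    have hf : ∀ u : ℝ, Measurable fun θ : ℝ => ⌊u - θ⌋ := fun u =>
      Int.measurable_floor.comp (measurable_const.sub measurable_id)
    have hm : MeasurableSet {θ | a ∈ A θ} := by
      simp only [hA, Finset.mem_filter, Finset.mem_univ, true_and]
      exact measurableSet_lt (hf _) (hf _)
    by_cases hB : a ∈ B
    · simpa [hB] using hm
    · simp only [hB, iff_false]
      exact hm.compl
  obtain ⟨μ, hμ, hsupp⟩ := exists_pmf_expect_eq_integral A hmeas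
  refine ⟨μ, fun a => ?_, fun B hB => ?_, fun B hB l h hlh h1 => ?_, fun B hB l h hlh h1 => ?_⟩
  · have h1 : ∀ θ, (if a ∈ A θ then (1 : ℝ) else 0) =
        ((⌊s a + y a - θ⌋ : ℤ) : ℝ) - ((⌊s a - θ⌋ : ℤ) : ℝ) := fun θ => by
      have h2 : ⌊s a - θ⌋ ≤ ⌊s a + y a - θ⌋ := Int.floor_le_floor (by linarith [hy0 a])
      have h3 : ⌊s a + y a - θ⌋ ≤ ⌊s a - θ⌋ + 1 := by
        rw [← Int.floor_add_one]
        exact Int.floor_le_floor (by linarith [hy1 a])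
      simp only [hA, Finset.mem_filter, Finset.mem_univ, true_and]
      split_ifs with h4
      · have : ⌊s a + y a - θ⌋ = ⌊s a - θ⌋ + 1 := by omega
        rw [this]; push_cast; ring
      · have : ⌊s a + y a - θ⌋ = ⌊s a - θ⌋ := by omega
        rw [this]; ring
    have h2 := hμ (fun B => if a ∈ B then 1 else 0)
    simp only [h1, integral_floor_sub_sub_floor_sub] at h2
    rw [add_sub_cancel_left (s a) (y a)] at h2
    rw [prob, ← h2]
    exact congrArg _ (funext fun B => by congr)
  · obtain ⟨θ, rfl⟩ := hsupp B hB
    obtain ⟨T, hT⟩ : ∃ T, ∀ a, color a < T :=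
      ⟨(Finset.univ.sup color) + 1, fun a => Nat.lt_succ_of_le (Finset.le_sup (Finset.mem_univ a))⟩
    have h1 := hcount θ T
    simp only [hT, Finset.filter_true, hk] at h1
    have h2 : ⌊(k : ℝ) - θ⌋ = k + ⌊-θ⌋ := by
      rw [sub_eq_add_neg, Int.floor_natCast_add]
    omega
  · obtain ⟨θ, rfl⟩ := hsupp B hB
    have h2 := hblock θ l h hlh
    have h3 : ⌊(∑ b with color b < l, y b) - θ⌋ + 1 ≤
        ⌊(∑ b with color b < l, y b) + (∑ a with l ≤ color a ∧ color a < h, y a) - θ⌋ := by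
      rw [← Int.floor_add_one]
      exact Int.floor_le_floor (by linarith)
    rw [← Finset.card_pos]
    omega
  · obtain ⟨θ, rfl⟩ := hsupp B hB
    have h2 := hblock θ l h hlh
    have h3 : ⌊(∑ b with color b < l, y b) + (∑ a with l ≤ color a ∧ color a < h, y a) - θ⌋ ≤
        ⌊(∑ b with color b < l, y b) - θ⌋ + 1 := by
      rw [← Int.floor_add_one]
      exact Int.floor_le_floor (by linarith)
    omega

end SystematicSampling

section

/-! ### Fractional assignments -/

section Assignments

variable {ι : Type*} [Fintype ι]

/-- An assignment that uses the cheap facilities to full capacity has the smallest cost. -/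
theorem sum_mul_le_of_exchange (f x x' y : ι → ℝ) (hx : ∑ a, x a = 1) (hx' : ∑ a, x' a = 1)
    (hxy : ∀ a, x a ≤ y a) (hx'0 : ∀ a, 0 ≤ x' a) (hx'y : ∀ a, x' a ≤ y a)
    (h : ∀ a b, 0 < x a → x b < y b → f a ≤ f b) :
    ∑ a, f a * x a ≤ ∑ a, f a * x' a := by
  classical
  have hne : (Finset.univ.filter fun a => 0 < x a).Nonempty := by
    by_contra hc
    rw [Finset.not_nonempty_iff_eq_empty, Finset.filter_eq_empty_iff] at hc
    have : ∑ a, x a ≤ 0 := Finset.sum_nonpos fun a ha => not_lt.1 (hc ha)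
    linarith
  obtain ⟨a₀, ha₀, hmax⟩ := Finset.exists_max_image _ f hne
  simp only [Finset.mem_filter, Finset.mem_univ, true_and] at ha₀ hmax
  -- Compare with the most expensive used facility `a₀`: cheaper ones are used fully, so `x'` uses
  -- them no more; dearer ones are unused by `x`. Each summand is nonnegative.
  have key : 0 ≤ ∑ a, (f a - f a₀) * (x' a - x a) := by
    refine Finset.sum_nonneg fun a _ => ?_
    rcases lt_trichotomy (f a) (f a₀) with hlt | heq | hgt
    · have h1 : x a = y a := (hxy a).antisymm (not_lt.1 fun hc => (h a₀ a ha₀ hc).not_gt hlt)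
      exact mul_nonneg_of_nonpos_of_nonpos (by linarith) (by linarith [hx'y a])
    · simp [heq]
    · have h1 : ¬ 0 < x a := fun hc => (hmax a hc).not_gt hgt
      exact mul_nonneg (by linarith) (by linarith [hx'0 a])
  have e : ∑ a, (f a - f a₀) * (x' a - x a) =
      ∑ a, f a * x' a - ∑ a, f a * x a - f a₀ * (∑ a, x' a - ∑ a, x a) := by
    rw [← Finset.sum_sub_distrib, ← Finset.sum_sub_distrib, Finset.mul_sum,
      ← Finset.sum_sub_distrib]
    exact Finset.sum_congr rfl fun a _ => by ring
  rw [e, hx, hx'] at key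
  linarith

/-- In an assignment of smallest cost, a facility that is cheaper than a used one is used to full
capacity. -/
theorem le_of_sum_mul_minimal (f x y : ι → ℝ) (hx : ∑ a, x a = 1)
    (hx0 : ∀ a, 0 ≤ x a) (hxy : ∀ a, x a ≤ y a)
    (hmin : ∀ z : ι → ℝ, (∀ a, 0 ≤ z a) → (∀ a, z a ≤ y a) → ∑ a, z a = 1 →
      ∑ a, f a * x a ≤ ∑ a, f a * z a)
    {a b : ι} (ha : 0 < x a) (hb : x b < y b) : f a ≤ f b := by
  classical
  by_contra hc
  rw [not_le] at hc
  have hab : a ≠ b := fun h => by rw [h] at hc; exact lt_irrefl _ hc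
  set ε := min (x a) (y b - x b)
  have hε : 0 < ε := lt_min ha (sub_pos.2 hb)
  have hε1 : ε ≤ x a := min_le_left _ _
  have hε2 : ε ≤ y b - x b := min_le_right _ _
  -- Shift mass ε from `a` to the cheaper `b`.
  set z : ι → ℝ := fun i => x i + ((if i = b then ε else 0) - if i = a then ε else 0) with hz
  have h1 := hmin z (fun i => ?_) (fun i => ?_) ?_
  · have e : ∑ i, f i * z i = ∑ i, f i * x i + (f b * ε - f a * ε) := by
      simp only [hz, mul_add, mul_sub, Finset.sum_add_distrib, Finset.sum_sub_distrib, mul_ite,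
        mul_zero, Finset.sum_ite_eq', Finset.mem_univ, if_true]
    rw [e] at h1
    nlinarith
  · simp only [hz]
    have := hx0 i
    split_ifs with h2 h3 h3
    · linarith
    · linarith
    · rw [h3]; linarith
    · linarith
  · simp only [hz]
    have := hxy i
    split_ifs with h2 h3 h3
    · linarith
    · rw [h2]; linarith
    · linarith
    · linarith
  · simp only [hz, Finset.sum_add_distrib, Finset.sum_sub_distrib, Finset.sum_ite_eq',
      Finset.mem_univ, if_true, hx]
    ring

variable {k n : ℕ} {x x' : ι → Fin n → ℝ} {y : ι → ℝ}

/-- For fixed `y` the clients do not interact, so minimality of the whole assignment gives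
minimality for each client. -/
theorem LPFeasible.update_client (h : LPFeasible k n x y) (j : Fin n) (z : ι → ℝ)
    (hz0 : ∀ a, 0 ≤ z a) (hzy : ∀ a, z a ≤ y a) (hz : ∑ a, z a = 1) :
    LPFeasible k n (fun a => Function.update (x a) j (z a)) y where
  x_le_y a j' := by
    rcases eq_or_ne j' j with rfl | hne
    · simpa using hzy a
    · simpa [hne] using h.x_le_y a j'
  served j' := by
    rcases eq_or_ne j' j with rfl | hne
    · simpa using hz
    · simpa [hne] using h.served j'
  opened := h.opened
  x_nonneg a j' := by
    rcases eq_or_ne j' j with rfl | hne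
    · simpa using hz0 a
    · simpa [hne] using h.x_nonneg a j'
  x_le_one a j' := by
    rcases eq_or_ne j' j with rfl | hne
    · simpa using (hzy a).trans (h.y_le_one a)
    · simpa [hne] using h.x_le_one a j'
  y_nonneg := h.y_nonneg
  y_le_one := h.y_le_one

theorem lpValue_eq_sum_clients (f : ι → Fin n → ℝ) (x : ι → Fin n → ℝ) :
    lpValue f x = ∑ j, ∑ a, f a j * x a j := Finset.sum_comm

/-- The exchange property of a cost-minimal assignment, for a fixed opening vector. -/
theorem LPFeasible.exchange (h : LPFeasible k n x y) {f : ι → Fin n → ℝ}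
    (hmin : ∀ x', LPFeasible k n x' y → lpValue f x ≤ lpValue f x') {a b : ι} {j : Fin n}
    (ha : 0 < x a j) (hb : x b j < y b) : f a j ≤ f b j := by
  refine le_of_sum_mul_minimal (fun a => f a j) (fun a => x a j) y (h.served j)
    (fun a => h.x_nonneg a j) (fun a => h.x_le_y a j) (fun z hz0 hzy hz => ?_) ha hb
  have h1 := hmin _ (h.update_client j z hz0 hzy hz)
  simp only [lpValue_eq_sum_clients] at h1
  rw [← Finset.add_sum_erase _ _ (Finset.mem_univ j),
    ← Finset.add_sum_erase _ _ (Finset.mem_univ j)] at h1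
  have h2 : ∑ j' ∈ Finset.univ.erase j, ∑ a, f a j' * Function.update (x a) j (z a) j' =
      ∑ j' ∈ Finset.univ.erase j, ∑ a, f a j' * x a j' := by
    refine Finset.sum_congr rfl fun j' hj' => Finset.sum_congr rfl fun a _ => ?_
    rw [Function.update_of_ne (Finset.ne_of_mem_erase hj')]
  rw [h2] at h1
  simpa using le_of_add_le_add_right h1

/-- Converse of `LPFeasible.exchange`, client by client. The cost `f` need not be the one that
produced `x`; this lets one assignment be optimal for several costs. -/
theorem LPFeasible.lpValue_le_of_exchange (h : LPFeasible k n x y) (h' : LPFeasible k n x' y)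
    {f : ι → Fin n → ℝ} (hf : ∀ a b j, 0 < x a j → x b j < y b → f a j ≤ f b j) :
    lpValue f x ≤ lpValue f x' := by
  simp only [lpValue_eq_sum_clients]
  exact Finset.sum_le_sum fun j _ => sum_mul_le_of_exchange (fun a => f a j) (fun a => x a j)
    (fun a => x' a j) y (h.served j) (h'.served j)
    (fun a => h.x_le_y a j) (fun a => h'.x_nonneg a j) (fun a => h'.x_le_y a j)
    fun a b => hf a b j

theorem isCompact_lpFeasible (ι : Type*) [Fintype ι] (k n : ℕ) :
    IsCompact {p : (ι → Fin n → ℝ) × (ι → ℝ) | LPFeasible k n p.1 p.2} := by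
  refine IsCompact.of_isClosed_subset
    (isCompact_Icc (a := (0 : (ι → Fin n → ℝ) × (ι → ℝ))) (b := 1)) ?_ ?_
  · have e : {p : (ι → Fin n → ℝ) × (ι → ℝ) | LPFeasible k n p.1 p.2} =
        {p | (∀ i j, p.1 i j ≤ p.2 i) ∧ (∀ j, ∑ i, p.1 i j = 1) ∧ (∑ i, p.2 i = (k : ℝ)) ∧
          (∀ i j, 0 ≤ p.1 i j) ∧ (∀ i j, p.1 i j ≤ 1) ∧ (∀ i, 0 ≤ p.2 i) ∧ ∀ i, p.2 i ≤ 1} := by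
      ext p
      exact ⟨fun h => ⟨h.1, h.2, h.3, h.4, h.5, h.6, h.7⟩,
        fun ⟨h1, h2, h3, h4, h5, h6, h7⟩ => ⟨h1, h2, h3, h4, h5, h6, h7⟩⟩
    rw [e]
    simp only [Set.ofPred_and, Set.ofPred_forall]
    have hx : ∀ i j, Continuous fun p : (ι → Fin n → ℝ) × (ι → ℝ) => p.1 i j := fun i j => by
      fun_prop
    have hy : ∀ i, Continuous fun p : (ι → Fin n → ℝ) × (ι → ℝ) => p.2 i := fun i => by fun_prop
    refine IsClosed.inter ?_ (IsClosed.inter ?_ (IsClosed.inter ?_ (IsClosed.inter ?_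
      (IsClosed.inter ?_ (IsClosed.inter ?_ ?_)))))
    · exact isClosed_iInter fun i => isClosed_iInter fun j => isClosed_le (hx i j) (hy i)
    · exact isClosed_iInter fun j =>
        isClosed_eq (continuous_finsetSum _ fun i _ => hx i j) continuous_const
    · exact isClosed_eq (continuous_finsetSum _ fun i _ => hy i) continuous_const
    · exact isClosed_iInter fun i => isClosed_iInter fun j => isClosed_le continuous_const (hx i j)
    · exact isClosed_iInter fun i => isClosed_iInter fun j => isClosed_le (hx i j) continuous_const
    · exact isClosed_iInter fun i => isClosed_le continuous_const (hy i)
    · exact isClosed_iInter fun i => isClosed_le (hy i) continuous_const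
  · intro p h
    exact ⟨⟨fun i j => h.x_nonneg i j, fun i => h.y_nonneg i⟩,
      ⟨fun i j => h.x_le_one i j, fun i => h.y_le_one i⟩⟩

theorem continuous_lpValue (f : ι → Fin n → ℝ) :
    Continuous fun p : (ι → Fin n → ℝ) × (ι → ℝ) => lpValue f p.1 := by
  unfold lpValue
  fun_prop

theorem exists_lp_minimizer (h : LPFeasible k n x y) (f : ι → Fin n → ℝ) :
    ∃ x₀ y₀, LPFeasible k n x₀ y₀ ∧
      ∀ (x' : ι → Fin n → ℝ) (y' : ι → ℝ), LPFeasible k n x' y' → lpValue f x₀ ≤ lpValue f x' := by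
  obtain ⟨p, hp, hmin⟩ := (isCompact_lpFeasible ι k n).exists_isMinOn ⟨(x, y), h⟩
    (continuous_lpValue f).continuousOn
  exact ⟨p.1, p.2, hp, fun x' y' h' => hmin (a := (x', y')) h'⟩

theorem LPFeasible.exists_minimizer (h : LPFeasible k n x y) (f : ι → Fin n → ℝ) :
    ∃ x₀, LPFeasible k n x₀ y ∧ ∀ x', LPFeasible k n x' y → lpValue f x₀ ≤ lpValue f x' := by
  have hc : IsClosed {p : (ι → Fin n → ℝ) × (ι → ℝ) | p.2 = y} :=
    isClosed_eq continuous_snd continuous_const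
  obtain ⟨p, ⟨hp, hpy⟩, hmin⟩ := ((isCompact_lpFeasible ι k n).inter_right hc).exists_isMinOn
    ⟨(x, y), h, rfl⟩ (continuous_lpValue f).continuousOn
  obtain ⟨x₀, y₀⟩ := p
  obtain rfl : y₀ = y := hpy
  exact ⟨x₀, hp, fun x' h' => hmin (a := (x', y₀)) ⟨h', rfl⟩⟩

end Assignments

/-! ### Splitting facilities -/

/-- δ v is the gap between v and the preceding element of `V` (or 0), so the sums telescope. These
gaps become the openings of the copies of a facility. -/
theorem exists_increments (V : Finset ℝ) (hV : ∀ v ∈ V, 0 < v) :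
    ∃ δ : ℝ → ℝ, (∀ v ∈ V, 0 < δ v) ∧ ∀ z ∈ V, ∑ v ∈ V with v ≤ z, δ v = z := by
  induction V using Finset.induction_on_max with
  | empty => exact ⟨fun _ => 0, by simp, by simp⟩
  | insert M V hM ih =>
    obtain ⟨δ, h1, h2⟩ := ih fun v hv => hV v (Finset.mem_insert_of_mem hv)
    have hMV : M ∉ V := fun h => lt_irrefl _ (hM M h)
    have hlt : ∑ v ∈ V, δ v < M := by
      rcases V.eq_empty_or_nonempty with rfl | hne
      · simpa using hV M (by simp)
      · have h3 := h2 _ (V.max'_mem hne)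
        rw [Finset.filter_true_of_mem fun v hv => V.le_max' v hv] at h3
        rw [h3]
        exact hM _ (V.max'_mem hne)
    have hupd : ∀ v ∈ V, Function.update δ M (M - ∑ v ∈ V, δ v) v = δ v := fun v hv =>
      Function.update_of_ne (hM v hv).ne _ _
    refine ⟨Function.update δ M (M - ∑ v ∈ V, δ v), fun v hv => ?_, fun z hz => ?_⟩
    · rcases Finset.mem_insert.1 hv with rfl | hv
      · simpa using hlt
      · rw [hupd v hv]
        exact h1 v hv
    · rcases Finset.mem_insert.1 hz with rfl | hz
      · rw [Finset.filter_true_of_mem fun v hv => ?_, Finset.sum_insert hMV,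
          Finset.sum_congr rfl hupd]
        · simp
        · rcases Finset.mem_insert.1 hv with rfl | hv
          · exact le_rfl
          · exact (hM v hv).le
      · rw [Finset.filter_insert, if_neg (hM z hz).not_ge,
          Finset.sum_congr rfl fun v hv => hupd v (Finset.mem_filter.1 hv).1]
        exact h2 z hz

/-- Each facility gets one copy per positive value among its `y i` and `x i j`; the copy of value v
has the gap below v as opening and serves j iff v ≤ `x i j`. A facility with `y i = 0` gets no copy.
-/
theorem exists_split {m n : ℕ} (x : Fin m → Fin n → ℝ) (y : Fin m → ℝ)
    (hx0 : ∀ i j, 0 ≤ x i j) (hy0 : ∀ i, 0 ≤ y i) (hxy : ∀ i j, x i j ≤ y i) :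
    ∃ S : SplitSolution m n, S.totalX = x ∧ S.totalY = y ∧ (∀ a, 0 < S.y a) ∧
      ∀ a j, S.x a j = 0 ∨ S.x a j = S.y a := by
  classical
  let V : Fin m → Finset ℝ := fun i =>
    (insert (y i) (Finset.univ.image (x i))).filter fun v => 0 < v
  have hV : ∀ i, ∀ v ∈ V i, 0 < v := fun i v hv => (Finset.mem_filter.1 hv).2
  choose δ hδ0 hδ using fun i => exists_increments (V i) (hV i)
  let e : Fin (Fintype.card ((i : Fin m) × V i)) ≃ (i : Fin m) × V i := (Fintype.equivFin _).symm
  have hsum : ∀ (i : Fin m) (z : ℝ), 0 ≤ z → (0 < z → z ∈ V i) →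
      ∑ v : V i, (if (v : ℝ) ≤ z then δ i v else 0) = z := fun i z hz hzV => by
    rw [Finset.sum_coe_sort (V i) (fun v => if v ≤ z then δ i v else 0), ← Finset.sum_filter]
    rcases hz.lt_or_eq with h | rfl
    · exact hδ i z (hzV h)
    · rw [Finset.filter_false_of_mem fun v hv => (hV i v hv).not_ge, Finset.sum_empty]
  have htotal : ∀ (i : Fin m) (f : ((i : Fin m) × V i) → ℝ),
      (∑ a with (e a).1 = i, f (e a)) = ∑ v : V i, f ⟨i, v⟩ := fun i f => by
    rw [Finset.sum_filter, Equiv.sum_comp e (fun p => if p.1 = i then f p else 0),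
      Fintype.sum_sigma, Finset.sum_eq_single i]
    · simp
    · intro i' _ hne
      simp [hne]
    · simp
  refine ⟨⟨_, fun a => (e a).1, fun a j => if ((e a).2 : ℝ) ≤ x (e a).1 j then δ (e a).1 (e a).2
    else 0, fun a => δ (e a).1 (e a).2⟩, ?_, ?_, ?_, ?_⟩
  · funext i j
    refine (htotal i fun p => if (p.2 : ℝ) ≤ x p.1 j then δ p.1 p.2 else 0).trans
      (hsum i _ (hx0 i j) fun h => ?_)
    simp [V, h]
  · funext i
    refine (htotal i fun p => δ p.1 p.2).trans (Eq.trans ?_ (hsum i (y i) (hy0 i) fun h => ?_))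
    · refine Finset.sum_congr rfl fun v _ => (if_pos ?_).symm
      have := (Finset.mem_filter.1 v.2).1
      rw [Finset.mem_insert, Finset.mem_image] at this
      rcases this with h | ⟨j, _, h⟩
      · exact h.le
      · exact h ▸ hxy i j
    · simp [V, h]
  · exact fun a => hδ0 _ _ (e a).2.2
  · intro a j
    dsimp only
    split_ifs
    · exact Or.inr rfl
    · exact Or.inl rfl

section Totals

variable {m n : ℕ} (S : SplitSolution m n)

theorem sum_mul_totalX (f : Fin m → ℝ) (j : Fin n) :
    ∑ i, f i * S.totalX i j = ∑ a, f (S.origin a) * S.x a j := by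
  rw [← Finset.sum_fiberwise _ S.origin]
  refine Finset.sum_congr rfl fun i _ => ?_
  rw [SplitSolution.totalX, Finset.mul_sum]
  refine Finset.sum_congr rfl fun a ha => ?_
  rw [(Finset.mem_filter.1 ha).2]

theorem sum_totalX (j : Fin n) : ∑ i, S.totalX i j = ∑ a, S.x a j := by
  simpa using sum_mul_totalX S (fun _ => 1) j

theorem sum_totalY : ∑ i, S.totalY i = ∑ a, S.y a :=
  Finset.sum_fiberwise _ S.origin _

theorem lpValue_totalX (f : Fin m → Fin n → ℝ) :
    lpValue f S.totalX = lpValue (fun a j => f (S.origin a) j) S.x := by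
  simp only [lpValue_eq_sum_clients, fun j => sum_mul_totalX S (fun i => f i j) j]

end Totals

variable {X : Type*} [PseudoMetricSpace X] {m n : ℕ} (I : OrderedKMedian X m n)

theorem c_nonneg (i : Fin m) (j : Fin n) : 0 ≤ I.c i j := dist_nonneg

/-- Splitting an assignment with the exchange property leads to the canonical form. -/
theorem exists_canonical {x : Fin m → Fin n → ℝ} {y : Fin m → ℝ} (h : LPFeasible I.k n x y)
    (hex : ∀ i i' j, 0 < x i j → x i' j < y i' → I.c i j ≤ I.c i' j) :
    ∃ S : SplitSolution m n, I.IsCanonical S ∧ S.totalX = x ∧ S.totalY = y := by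
  obtain ⟨S, hX, hY, hpos, hxy⟩ := exists_split x y h.x_nonneg h.y_nonneg h.x_le_y
  have hle : ∀ a j, S.x a j ≤ S.y a := fun a j => by
    rcases hxy a j with h1 | h1
    · exact h1 ▸ (hpos a).le
    · exact h1.le
  have hnn : ∀ a j, 0 ≤ S.x a j := fun a j => by
    rcases hxy a j with h1 | h1
    · exact h1.ge
    · exact h1 ▸ (hpos a).le
  have hle1 : ∀ a, S.y a ≤ 1 := fun a => by
    refine le_trans ?_ (h.y_le_one (S.origin a))
    rw [← hY]
    exact Finset.single_le_sum (f := S.y) (fun b _ => (hpos b).le)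
      (Finset.mem_filter.2 ⟨Finset.mem_univ a, rfl⟩)
  have hfeas : LPFeasible I.k n S.x S.y :=
    ⟨hle, fun j => by rw [← sum_totalX, hX, h.served], by rw [← sum_totalY, hY, h.opened], hnn,
      fun a j => (hle a j).trans (hle1 a), fun a => (hpos a).le, hle1⟩
  refine ⟨S, ⟨hfeas, hpos, hxy, fun x' h' => hfeas.lpValue_le_of_exchange h'
    fun a b j ha hb => hex _ _ j ?_ ?_⟩, hX, hY⟩
  · refine ha.trans_le ?_
    rw [← hX]
    exact Finset.single_le_sum (f := fun b => S.x b j) (fun b _ => hnn b j)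
      (Finset.mem_filter.2 ⟨Finset.mem_univ a, rfl⟩)
  · rw [← hX, ← hY]
    exact Finset.sum_lt_sum (fun a _ => hle a j)
      ⟨b, Finset.mem_filter.2 ⟨Finset.mem_univ b, rfl⟩, hb⟩

end

section

/-! ### Decomposition of the weights -/

section Levels

/-- δ r is v r − v (r + 1), with v continued by 0 after the last index. -/
theorem exists_decrements {R : ℕ} (v : Fin R → ℝ) (hv : Antitone v) (hv0 : ∀ r, 0 ≤ v r) :
    ∃ δ : Fin R → ℝ, (∀ r, 0 ≤ δ r) ∧ ∀ r, v r = ∑ r', if r ≤ r' then δ r' else 0 := by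
  induction R with
  | zero => exact ⟨fun _ => 0, fun _ => le_rfl, fun r => r.elim0⟩
  | succ R ih =>
    obtain ⟨δ, h1, h2⟩ := ih (fun r => v r.succ)
      (fun r r' h => hv (Fin.succ_le_succ_iff.2 h)) fun r => hv0 _
    have hle : ∑ r, δ r ≤ v 0 := by
      rcases R with _ | R
      · simpa using hv0 0
      · have h3 := h2 0
        simp only [Fin.zero_le, if_true] at h3
        rw [← h3]
        exact hv (Fin.zero_le _)
    refine ⟨Fin.cons (v 0 - ∑ r, δ r) δ, fun r => ?_, fun r => ?_⟩
    · refine Fin.cases ?_ (fun r => ?_) r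
      · simpa using hle
      · simpa using h1 r
    · refine Fin.cases ?_ (fun r => ?_) r
      · simp [Fin.sum_univ_succ]
      · simp [Fin.sum_univ_succ, h2 r]

/-- The left side selects v at the first r with `e r`; as `e` persists from there on, this is the
tail sum of δ. It turns the definition of `pairWeight` into a sum over thresholds. -/
theorem sum_first_level {R : ℕ} {v δ : Fin R → ℝ}
    (hδ : ∀ r, v r = ∑ r', if r ≤ r' then δ r' else 0) (e : Fin R → Prop) [DecidablePred e]
    [∀ r, Decidable (e r ∧ ∀ r' < r, ¬ e r')] (he : ∀ r r', r ≤ r' → e r → e r') :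
    (∑ r, if e r ∧ ∀ r' < r, ¬ e r' then v r else 0) = ∑ r, if e r then δ r else 0 := by
  by_cases h : ∃ r, e r
  · obtain ⟨r₀, h0, hmin⟩ : ∃ r₀, e r₀ ∧ ∀ r, e r → r₀ ≤ r := by
      have hne : (Finset.univ.filter e).Nonempty := h.imp fun r hr => by simpa using hr
      refine ⟨(Finset.univ.filter e).min' hne, ?_, fun r hr => Finset.min'_le _ _ (by simpa using hr)⟩
      simpa using Finset.min'_mem _ hne
    have e1 : ∀ r, (e r ∧ ∀ r' < r, ¬ e r') ↔ r = r₀ := fun r => by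
      constructor
      · rintro ⟨hr, hlt⟩
        exact le_antisymm (not_lt.1 fun hc => hlt _ hc h0) (hmin r hr)
      · rintro rfl
        exact ⟨h0, fun r' hr' hc => (hmin r' hc).not_gt hr'⟩
    have e2 : ∀ r, e r ↔ r₀ ≤ r := fun r => ⟨hmin r, fun hr => he _ _ hr h0⟩
    simp only [e1, Finset.sum_ite_eq', Finset.mem_univ, if_true, hδ r₀]
    exact Finset.sum_congr rfl fun r _ => by simp only [e2]
  · have h' : ∀ r, ¬ e r := fun r hr => h ⟨r, hr⟩
    simp [h']

end Levels

variable {X : Type*} [PseudoMetricSpace X] {m n : ℕ} (I : OrderedKMedian X m n)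

theorem wbar_strictAnti : StrictAnti I.wbar := fun _ _ h =>
  (I.weightValues.orderEmbOfFin rfl).strictMono (Fin.rev_lt_rev.2 h)

theorem exists_w_eq_wbar (r : Fin I.R) : ∃ s, I.w s = I.wbar r := by
  obtain ⟨s, _, hs⟩ := Finset.mem_image.1 (I.weightValues.orderEmbOfFin_mem rfl (Fin.rev r))
  exact ⟨s, hs⟩

theorem exists_wbar_eq_w (s : Fin n) : ∃ r, I.w s = I.wbar r := by
  have h : I.w s ∈ Set.range (I.weightValues.orderEmbOfFin rfl) := by
    rw [Finset.range_orderEmbOfFin]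
    simp [weightValues]
  obtain ⟨r, hr⟩ : ∃ r : Fin I.R, I.weightValues.orderEmbOfFin rfl r = I.w s := h
  exact ⟨Fin.rev r, hr.symm.trans (congrArg _ (Fin.rev_rev r).symm)⟩

theorem wbar_nonneg (r : Fin I.R) : 0 ≤ I.wbar r := by
  obtain ⟨s, hs⟩ := I.exists_w_eq_wbar r
  exact hs ▸ I.w_nonneg s

/-- The differences of consecutive distinct weights. -/
def IsDecrement (δ : Fin I.R → ℝ) : Prop :=
  (∀ r, 0 ≤ δ r) ∧ ∀ r, I.wbar r = ∑ r', if r ≤ r' then δ r' else 0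

theorem exists_isDecrement : ∃ δ, I.IsDecrement δ :=
  exists_decrements I.wbar I.wbar_strictAnti.antitone I.wbar_nonneg

variable {I}

theorem IsDecrement.w_eq {δ : Fin I.R → ℝ} (hδ : I.IsDecrement δ) (s : Fin n) :
    I.w s = ∑ r, if I.wbar r ≤ I.w s then δ r else 0 := by
  obtain ⟨r₀, h0⟩ := I.exists_wbar_eq_w s
  rw [h0]
  refine (hδ.2 r₀).trans (Finset.sum_congr rfl fun r _ => ?_)
  simp only [I.wbar_strictAnti.le_iff_ge]

theorem IsDecrement.pairWeight_eq {δ : Fin I.R → ℝ} (hδ : I.IsDecrement δ)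
    {rank : Fin m × Fin n → ℕ} {g : I.Guess} (hg : I.IsDecreasing rank g) (i : Fin m) (j : Fin n) :
    I.pairWeight rank g i j = ∑ r, if rank (g r) ≤ rank (i, j) then δ r else 0 := by
  rw [← sum_first_level hδ.2 (fun r => rank (g r) ≤ rank (i, j))]
  · simp only [pairWeight, not_le]
  · intro r r' h hr
    rcases h.lt_or_eq with h | rfl
    · exact (hg r r' h).le.trans hr
    · exact hr

theorem IsRanking.c_le {rank : Fin m × Fin n → ℕ} (h : I.IsRanking rank) {p q : Fin m × Fin n}
    (hpq : rank p ≤ rank q) : I.c p.1 p.2 ≤ I.c q.1 q.2 :=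
  not_lt.1 fun hc => (h.2 q p hc).not_ge hpq

theorem reducedCost_mono {rank : Fin m × Fin n → ℕ} (h : I.IsRanking rank) {g : I.Guess}
    (hg : I.IsDecreasing rank g) {i i' : Fin m} {j : Fin n} (hij : rank (i, j) ≤ rank (i', j)) :
    I.reducedCost rank g i j ≤ I.reducedCost rank g i' j := by
  obtain ⟨δ, hδ⟩ := I.exists_isDecrement
  rw [reducedCost, reducedCost, hδ.pairWeight_eq hg, hδ.pairWeight_eq hg]
  refine mul_le_mul (h.c_le hij) (Finset.sum_le_sum fun r _ => ?_)
    (Finset.sum_nonneg fun r _ => ?_) (I.c_nonneg _ _)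
  · have := hδ.1 r
    split_ifs with h1 h2 h2
    · exact le_rfl
    · exact absurd (h1.trans hij) h2
    · exact this
    · exact le_rfl
  · have := hδ.1 r
    split_ifs <;> simp [this]

/-! ### Integral solutions -/

theorem nonempty_of_card_eq {W : Finset (Fin m)} (hW : W.card = I.k) : W.Nonempty :=
  Finset.card_pos.1 (hW ▸ I.one_le_k)

theorem exists_closest {W : Finset (Fin m)} (hW : W.Nonempty) (j : Fin n) :
    ∃ i ∈ W, I.c i j = I.connCost W j := by
  obtain ⟨i, hi, h⟩ := Finset.exists_mem_eq_inf' hW (fun i => I.c i j)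
  exact ⟨i, hi, by rw [connCost, dif_pos hW, h]⟩

theorem connCost_le {W : Finset (Fin m)} {i : Fin m} (hi : i ∈ W) (j : Fin n) :
    I.connCost W j ≤ I.c i j := by
  rw [connCost, dif_pos ⟨i, hi⟩]
  exact Finset.inf'_le _ hi

theorem lpFeasible_of_assignment {W : Finset (Fin m)} (hW : W.card = I.k) (a : Fin n → Fin m)
    (ha : ∀ j, a j ∈ W) :
    LPFeasible I.k n (fun i j => if i = a j then (1 : ℝ) else 0) fun i => if i ∈ W then 1 else 0 where
  x_le_y i j := by
    by_cases h : i = a j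
    · simp [h, ha j]
    · simp only [h, if_false]
      split_ifs <;> norm_num
  served j := by simp
  opened := by simp [hW]
  x_nonneg i j := by split_ifs <;> norm_num
  x_le_one i j := by split_ifs <;> norm_num
  y_nonneg i := by split_ifs <;> norm_num
  y_le_one i := by split_ifs <;> norm_num

theorem lpValue_of_assignment (f : Fin m → Fin n → ℝ) (a : Fin n → Fin m) :
    lpValue f (fun i j => if i = a j then (1 : ℝ) else 0) = ∑ j, f (a j) j := by
  simp [lpValue_eq_sum_clients]

theorem exists_isOptimum : ∃ W, I.IsOptimum W := by
  obtain ⟨W, hW, hmin⟩ := Finset.exists_min_image _ I.cost I.solutions_nonempty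
  refine ⟨W, (Finset.mem_powersetCard.1 hW).2, fun W' hW' => hmin W' ?_⟩
  exact Finset.mem_powersetCard.2 ⟨Finset.subset_univ _, hW'⟩

theorem IsOptimum.cost_eq {W : Finset (Fin m)} (hW : I.IsOptimum W) : I.cost W = I.opt := by
  refine le_antisymm (Finset.le_inf' _ _ fun W' hW' => hW.2 W' (Finset.mem_powersetCard.1 hW').2) ?_
  exact Finset.inf'_le _ (Finset.mem_powersetCard.2 ⟨Finset.subset_univ _, hW.1⟩)

/-! ### Existence of LP solvers -/

variable (I)

theorem exists_lpFeasible : ∃ (x : Fin m → Fin n → ℝ) (y : Fin m → ℝ), LPFeasible I.k n x y := by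
  obtain ⟨W, hW⟩ := I.exists_isOptimum
  choose a ha _ using fun j => exists_closest (I := I) (nonempty_of_card_eq hW.1) j
  exact ⟨_, _, lpFeasible_of_assignment hW.1 a ha⟩

theorem exists_isLPSolver {rank : Fin m × Fin n → ℕ} (hrank : I.IsRanking rank) :
    ∃ solve, I.IsLPSolver rank solve := by
  have main : ∀ g : I.Guess, ∃ S : SplitSolution m n, I.IsDecreasing rank g →
      I.IsCanonical S ∧ I.LPOptimal (I.reducedCost rank g) S.totalX S.totalY := fun g => by
    by_cases hg : I.IsDecreasing rank g
    · obtain ⟨x₁, y₁, h₁⟩ := I.exists_lpFeasible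
      obtain ⟨x₀, y, h₀, hmin₀⟩ := exists_lp_minimizer h₁ (I.reducedCost rank g)
      -- Keep the optimal `y`, but reassign by minimal total rank. Distances and reduced costs are
      -- both monotone in the rank, so the new assignment is optimal for both; minimizing distance
      -- alone could break ties against the reduced cost.
      obtain ⟨x, h, hmin⟩ := h₀.exists_minimizer fun i j => (rank (i, j) : ℝ)
      have hex : ∀ i i' j, 0 < x i j → x i' j < y i' → rank (i, j) ≤ rank (i', j) :=
        fun i i' j hi hi' => Nat.cast_le.1
          (h.exchange (f := fun i j => (rank (i, j) : ℝ)) hmin hi hi')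
      have hexc : ∀ i i' j, 0 < x i j → x i' j < y i' → I.c i j ≤ I.c i' j :=
        fun i i' j hi hi' => hrank.c_le (p := (i, j)) (q := (i', j)) (hex i i' j hi hi')
      obtain ⟨S, hS, hX, hY⟩ := I.exists_canonical h hexc
      refine ⟨S, fun _ => ⟨hS, ?_⟩⟩
      rw [hX, hY]
      have hle : lpValue (I.reducedCost rank g) x ≤ lpValue (I.reducedCost rank g) x₀ :=
        h.lpValue_le_of_exchange h₀ fun i i' j hi hi' =>
          reducedCost_mono hrank hg (hex i i' j hi hi')
      exact ⟨h, fun x' y' h' => hle.trans (hmin₀ x' y' h')⟩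
    · exact ⟨⟨0, Fin.elim0, Fin.elim0, Fin.elim0⟩, fun h => absurd h hg⟩
  choose solve hsolve using main
  exact ⟨solve, hsolve⟩

/-! ### Right guesses -/

variable {I} {rank : Fin m × Fin n → ℕ} {W : Finset (Fin m)} {g : I.Guess}

theorem exists_isRightGuess (hrank : I.IsRanking rank) (hW : W.Nonempty) :
    ∃ g, I.IsRightGuess rank W g := by
  choose a ha hac using fun j => exists_closest (I := I) hW j
  -- Negated, because `Tuple.sort` sorts increasingly while serving pairs have to decrease.
  set key : Fin n → ℤ := fun j => -(rank (a j, j) : ℤ) with hkey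
  have hmono : Monotone (key ∘ Tuple.sort key) := Tuple.monotone_sort key
  choose s₀ hs₀ using I.exists_w_eq_wbar
  have hlast : ∀ r, ∃ s, I.w s = I.wbar r ∧ ∀ t, I.w t = I.wbar r → t ≤ s := fun r => by
    have hne : (Finset.univ.filter fun s => I.w s = I.wbar r).Nonempty :=
      ⟨s₀ r, by simpa using hs₀ r⟩
    refine ⟨Finset.max' _ hne, ?_, fun t ht => Finset.le_max' (Finset.univ.filter fun s => I.w s = I.wbar r) t
      (by simpa using ht)⟩
    simpa using Finset.max'_mem _ hne
  choose s hs hs' using hlast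
  refine ⟨fun r => (a (Tuple.sort key (s r)), Tuple.sort key (s r)), Tuple.sort key, a,
    fun j => ⟨ha j, hac j⟩, fun t t' htt' => ?_, fun r => ⟨s r, rfl, hs r, hs' r⟩⟩
  refine lt_of_le_of_ne ?_ fun h => ?_
  · have h1 : ∀ j, key j = -(rank (a j, j) : ℤ) := fun _ => rfl
    have h2 := hmono htt'.le
    rw [Function.comp_apply, Function.comp_apply, h1, h1] at h2
    omega
  · have := congrArg Prod.snd (hrank.1 h)
    exact htt'.ne' ((Tuple.sort key).injective this)

theorem IsRightGuess.isDecreasing (hg : I.IsRightGuess rank W g) : I.IsDecreasing rank g := by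
  obtain ⟨σ, a, _, hσ, hlast⟩ := hg
  intro r r' hrr'
  obtain ⟨s, hgs, hws, _⟩ := hlast r
  obtain ⟨s', hgs', hws', _⟩ := hlast r'
  rw [hgs, hgs']
  refine hσ s s' (not_le.1 fun hc => ?_)
  have h1 := I.w_antitone hc
  rw [hws, hws'] at h1
  exact (I.wbar_strictAnti hrr').not_ge h1

/-- All orders that sort the costs give the same sorted vector, so the tie-breaking by rank does not
change the objective. -/
theorem sum_w_mul_eq_cost (σ : Equiv.Perm (Fin n)) (h : Antitone fun s => I.connCost W (σ s)) :
    ∑ s, I.w s * I.connCost W (σ s) = I.cost W := by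
  have h1 : (fun j => -I.connCost W j) ∘ σ =
      (fun j => -I.connCost W j) ∘ Tuple.sort (fun j => -I.connCost W j) :=
    Tuple.comp_sort_eq_comp_iff_monotone.2 fun s t hst => neg_le_neg (h hst)
  refine Finset.sum_congr rfl fun s _ => ?_
  have h2 := congrFun h1 s
  simp only [Function.comp_apply, neg_inj] at h2
  rw [sortedCost, h2]

/-- The consequences of a guess being right that matter for the analysis. -/
theorem IsRightGuess.exists_order (hrank : I.IsRanking rank) (hg : I.IsRightGuess rank W g) :
    ∃ (σ : Equiv.Perm (Fin n)) (a : Fin n → Fin m), (∀ j, a j ∈ W) ∧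
      (∑ s, I.w s * I.c (a (σ s)) (σ s) = I.cost W) ∧
      ∀ r s, rank (g r) ≤ rank (a (σ s), σ s) ↔ I.wbar r ≤ I.w s := by
  obtain ⟨σ, a, ha, hσ, hlast⟩ := hg
  refine ⟨σ, a, fun j => (ha j).1, ?_, fun r s => ?_⟩
  · rw [← sum_w_mul_eq_cost (I := I) (W := W) σ fun s t hst => ?_]
    · simp only [(ha _).2]
    · simp only [← (ha _).2]
      rcases hst.lt_or_eq with h | rfl
      · exact hrank.c_le (hσ s t h).le
      · exact le_rfl
  · obtain ⟨s', hgs, hws, hmax⟩ := hlast r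
    rw [hgs, ← hws]
    constructor
    · intro h
      exact I.w_antitone (not_lt.1 fun hc => (hσ s' s hc).not_ge h)
    · intro h
      -- A position after `s'` with weight at least `wbar r` would have weight exactly `wbar r`, but
      -- `s'` is the last such position.
      have hss : s ≤ s' := not_lt.1 fun hc =>
        (hmax s ((le_antisymm (I.w_antitone hc.le) h).trans hws)).not_gt hc
      rcases hss.lt_or_eq with h1 | rfl
      · exact (hσ s s' h1).le
      · exact le_rfl

/-- The reduced linear program of a right guess is a relaxation. -/
theorem IsRightGuess.lpValue_le (hrank : I.IsRanking rank) (hW : W.card = I.k)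
    (hg : I.IsRightGuess rank W g) {x : Fin m → Fin n → ℝ} {y : Fin m → ℝ}
    (hopt : I.LPOptimal (I.reducedCost rank g) x y) :
    lpValue (I.reducedCost rank g) x ≤ I.cost W := by
  obtain ⟨δ, hδ⟩ := I.exists_isDecrement
  obtain ⟨σ, a, ha, hcost, hlev⟩ := hg.exists_order hrank
  refine (hopt.2 _ _ (lpFeasible_of_assignment hW a ha)).trans (le_of_eq ?_)
  rw [lpValue_of_assignment, ← hcost, ← Equiv.sum_comp σ]
  refine Finset.sum_congr rfl fun s _ => ?_
  rw [reducedCost, hδ.pairWeight_eq hg.isDecreasing, hδ.w_eq s, mul_comm]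
  simp only [hlev]

/-- The thresholds of a right guess are bounded by the cost of the solution. -/
theorem IsRightGuess.sum_threshold_le (hrank : I.IsRanking rank)
    (hg : I.IsRightGuess rank W g) {δ : Fin I.R → ℝ} (hδ : I.IsDecrement δ) :
    ∑ r, δ r * ∑ s, (if I.wbar r ≤ I.w s then I.c (g r).1 (g r).2 else 0) ≤ I.cost W := by
  obtain ⟨σ, a, _, hcost, hlev⟩ := hg.exists_order hrank
  rw [← hcost]
  simp only [Finset.mul_sum]
  rw [Finset.sum_comm]
  refine Finset.sum_le_sum fun s _ => ?_
  rw [congrArg (· * I.c (a (σ s)) (σ s)) (hδ.w_eq s), Finset.sum_mul]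
  refine Finset.sum_le_sum fun r _ => ?_
  split_ifs with h
  · exact mul_le_mul_of_nonneg_left (hrank.c_le (q := (a (σ s), σ s)) ((hlev r s).2 h)) (hδ.1 r)
  · simp

/-- On each level a counted cost is at most τ plus its excess over τ, and excesses of uncounted
clients only add nonnegative terms. The excess sum no longer depends on the sorting, so expectations
can be taken client by client. -/
theorem cost_le_sum_levels {δ : Fin I.R → ℝ} (hδ : I.IsDecrement δ) (A : Finset (Fin m))
    (τ : Fin I.R → ℝ) :
    I.cost A ≤ ∑ r, δ r * (∑ s, (if I.wbar r ≤ I.w s then τ r else 0) +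
      ∑ j, max (I.connCost A j - τ r) 0) := by
  have h1 : I.cost A = ∑ r, δ r * ∑ s, if I.wbar r ≤ I.w s then I.sortedCost A s else 0 := by
    simp only [Finset.mul_sum]
    rw [Finset.sum_comm]
    refine Finset.sum_congr rfl fun s _ => ?_
    nth_rw 1 [hδ.w_eq s]
    rw [Finset.sum_mul]
    exact Finset.sum_congr rfl fun r _ => by split_ifs <;> simp
  rw [h1]
  refine Finset.sum_le_sum fun r _ => mul_le_mul_of_nonneg_left ?_ (hδ.1 r)
  have h2 : ∑ j, max (I.connCost A j - τ r) 0 = ∑ s, max (I.sortedCost A s - τ r) 0 :=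
    (Equiv.sum_comp (Tuple.sort fun j => -I.connCost A j)
      fun j => max (I.connCost A j - τ r) 0).symm
  rw [h2, ← Finset.sum_add_distrib]
  refine Finset.sum_le_sum fun s _ => ?_
  split_ifs
  · linarith [le_max_left (I.sortedCost A s - τ r) 0]
  · linarith [le_max_right (I.sortedCost A s - τ r) 0]

theorem lpValue_reducedCost_eq {δ : Fin I.R → ℝ} (hδ : I.IsDecrement δ)
    (hg : I.IsDecreasing rank g) (S : SplitSolution m n) :
    lpValue (I.reducedCost rank g) S.totalX = ∑ r, δ r * ∑ j, ∑ a,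
      if rank (g r) ≤ rank (S.origin a, j) then S.x a j * I.c (S.origin a) j else 0 := by
  rw [lpValue_totalX, lpValue_eq_sum_clients]
  simp only [Finset.mul_sum]
  refine Eq.trans (Finset.sum_congr rfl fun j _ => ?_) Finset.sum_comm
  refine Eq.trans (Finset.sum_congr rfl fun a _ => ?_) Finset.sum_comm
  rw [reducedCost, hδ.pairWeight_eq hg, Finset.mul_sum, Finset.sum_mul]
  refine Finset.sum_congr rfl fun r _ => ?_
  split_ifs
  · ring
  · simp

end

section

variable {X : Type*} [PseudoMetricSpace X] {m n : ℕ} {I : OrderedKMedian X m n}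
  {S : SplitSolution m n}

/-! ### Triangle inequalities and basic facts on canonical solutions -/

theorem cc_comm (j j' : Fin n) : I.cc j j' = I.cc j' j := dist_comm _ _

theorem cc_nonneg (j j' : Fin n) : 0 ≤ I.cc j j' := dist_nonneg

theorem c_triangle (i : Fin m) (j j' : Fin n) : I.c i j' ≤ I.c i j + I.cc j j' :=
  dist_triangle _ _ _

theorem cc_le_add (i : Fin m) (j j' : Fin n) : I.cc j j' ≤ I.c i j + I.c i j' :=
  dist_triangle_left _ _ _

theorem IsCanonical.cav_nonneg (hS : I.IsCanonical S) (j : Fin n) : 0 ≤ I.cav S j :=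
  Finset.sum_nonneg fun a _ => mul_nonneg (hS.feasible.x_nonneg a j) (I.c_nonneg _ _)

theorem IsCanonical.x_eq_y (hS : I.IsCanonical S) {a : Fin S.N} {j : Fin n} (h : 0 < S.x a j) :
    S.x a j = S.y a :=
  (hS.x_eq a j).resolve_left h.ne'

/-! ### Clustering -/

variable (I S) in
theorem exists_obliviousClustering (Q : Finset (Fin n)) : ∃ D, I.ObliviousClustering S Q D := by
  induction Q using Finset.strongInduction with
  | H Q ih =>
    rcases Q.eq_empty_or_nonempty with rfl | hne
    · exact ⟨∅, .done⟩
    · obtain ⟨j, hj, hmin⟩ := Finset.exists_min_image Q (I.cav S) hne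
      obtain ⟨D, hD⟩ := ih ((Q.erase j).filter fun j' => ¬ I.cc j j' ≤ 4 * I.cav S j')
        ((Finset.filter_subset _ _).trans_ssubset (Finset.erase_ssubset hj))
      exact ⟨_, .step Q D j hj hmin hD⟩

theorem ObliviousClustering.subset {Q D : Finset (Fin n)} (h : I.ObliviousClustering S Q D) :
    D ⊆ Q := by
  induction h with
  | done => exact Finset.Subset.refl _
  | step Q D j hj _ _ ih =>
    refine Finset.insert_subset hj (ih.trans ?_)
    exact (Finset.filter_subset _ _).trans (Finset.erase_subset _ _)

/-- A later center survived the deletion by the earlier one, which bounds its own average cost; the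
earlier center has an even smaller average cost. -/
theorem ObliviousClustering.separated {Q D : Finset (Fin n)} (h : I.ObliviousClustering S Q D) :
    ∀ j ∈ D, ∀ j' ∈ D, j ≠ j' → 4 * I.cav S j < I.cc j j' := by
  induction h with
  | done => simp
  | step Q D j hj hmin hrest ih =>
    have h1 : ∀ j' ∈ D, 4 * I.cav S j' < I.cc j j' ∧ I.cav S j ≤ I.cav S j' := fun j' hj' => by
      have h2 := Finset.mem_filter.1 (hrest.subset hj')
      exact ⟨not_le.1 h2.2, hmin j' (Finset.mem_of_mem_erase h2.1)⟩
    intro i hi i' hi' hne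
    rcases Finset.mem_insert.1 hi with rfl | hiD <;> rcases Finset.mem_insert.1 hi' with rfl | hiD'
    · exact absurd rfl hne
    · have := h1 i' hiD'
      linarith
    · rw [cc_comm]
      exact (h1 i hiD).1
    · exact ih i hiD i' hiD' hne

/-- The center that removes j was chosen while j was still present, hence has no larger average
cost. Nonnegativity makes a center cover itself. -/
theorem ObliviousClustering.covered {Q D : Finset (Fin n)} (h : I.ObliviousClustering S Q D)
    (hcav : ∀ j, 0 ≤ I.cav S j) :
    ∀ j ∈ Q, ∃ j' ∈ D, I.cc j' j ≤ 4 * I.cav S j ∧ I.cav S j' ≤ I.cav S j := by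
  induction h with
  | done => simp
  | step Q D j hj hmin _ ih =>
    intro i hi
    by_cases hij : I.cc j i ≤ 4 * I.cav S i
    · exact ⟨j, Finset.mem_insert_self _ _, hij, hmin i hi⟩
    · have hne : i ≠ j := by
        rintro rfl
        exact hij (by simpa [cc] using hcav i)
      obtain ⟨j', hj', h'⟩ := ih i (Finset.mem_filter.2 ⟨Finset.mem_erase.2 ⟨hne, hi⟩, hij⟩)
      exact ⟨j', Finset.mem_insert_of_mem hj', h'⟩

/-! ### Bundles -/

theorem mem_bundle {D : Finset (Fin n)} {j : Fin n} {a : Fin S.N} :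
    a ∈ I.bundle S D j ↔
      (∀ j' ∈ D, j' ≠ j → I.c (S.origin a) j < I.cc j j' / 2) ∧ 0 < S.x a j := by
  simp [bundle]

theorem bundle_disjoint {D : Finset (Fin n)} {j j' : Fin n} (hj : j ∈ D) (hj' : j' ∈ D)
    (hne : j ≠ j') : Disjoint (I.bundle S D j) (I.bundle S D j') := by
  rw [Finset.disjoint_left]
  intro a ha ha'
  have h1 := (mem_bundle.1 ha).1 j' hj' hne.symm
  have h2 := (mem_bundle.1 ha').1 j hj hne
  have h3 := I.cc_le_add (S.origin a) j j'
  rw [cc_comm] at h2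
  linarith

theorem IsCanonical.sum_bundle_y (hS : I.IsCanonical S) (D : Finset (Fin n)) (j : Fin n) :
    ∑ a ∈ I.bundle S D j, S.y a = ∑ a ∈ I.bundle S D j, S.x a j :=
  Finset.sum_congr rfl fun _ ha => (hS.x_eq_y (mem_bundle.1 ha).2).symm

theorem IsCanonical.one_sub_sum_bundle (hS : I.IsCanonical S) (D : Finset (Fin n)) (j : Fin n) :
    1 - ∑ a ∈ I.bundle S D j, S.y a = ∑ a ∈ (I.bundle S D j)ᶜ, S.x a j := by
  rw [hS.sum_bundle_y, ← hS.feasible.served j,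
    ← Finset.sum_add_sum_compl (I.bundle S D j) fun a => S.x a j]
  ring

theorem IsCanonical.sum_bundle_le (hS : I.IsCanonical S) (D : Finset (Fin n)) (j : Fin n) :
    ∑ a ∈ I.bundle S D j, S.y a ≤ 1 := by
  have h := hS.one_sub_sum_bundle D j
  have : 0 ≤ ∑ a ∈ (I.bundle S D j)ᶜ, S.x a j :=
    Finset.sum_nonneg fun a _ => hS.feasible.x_nonneg a j
  linarith

/-- Markov's inequality: copies that serve j from outside the bundle are farther than 2 cav(j), so
they carry at most half of the assignment. -/
theorem IsCanonical.half_le_sum_bundle (hS : I.IsCanonical S) {D : Finset (Fin n)} {j : Fin n}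
    (hsep : ∀ j' ∈ D, j ≠ j' → 4 * I.cav S j < I.cc j j') :
    1 / 2 ≤ ∑ a ∈ I.bundle S D j, S.y a := by
  have h := hS.one_sub_sum_bundle D j
  by_contra hc
  have hq : 1 / 2 < ∑ a ∈ (I.bundle S D j)ᶜ, S.x a j := by linarith
  have hfar : ∀ a ∈ (I.bundle S D j)ᶜ, 0 < S.x a j → 2 * I.cav S j < I.c (S.origin a) j := by
    intro a ha hx
    rw [Finset.mem_compl, mem_bundle, not_and_or] at ha
    rcases ha with ha | ha
    · push Not at ha
      obtain ⟨j', hj', hne, hle⟩ := ha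
      have := hsep j' hj' hne.symm
      linarith
    · exact absurd hx ha
  have hlt : ∑ a ∈ (I.bundle S D j)ᶜ, S.x a j * (2 * I.cav S j) <
      ∑ a ∈ (I.bundle S D j)ᶜ, S.x a j * I.c (S.origin a) j := by
    refine Finset.sum_lt_sum (fun a ha => ?_) ?_
    · rcases (hS.feasible.x_nonneg a j).lt_or_eq with hx | hx
      · exact (mul_lt_mul_of_pos_left (hfar a ha hx) hx).le
      · simp [← hx]
    · obtain ⟨a, ha, hx⟩ := Finset.exists_lt_of_sum_lt (s := (I.bundle S D j)ᶜ)
        (f := fun _ => (0 : ℝ)) (g := fun a => S.x a j) (by simp; linarith)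
      exact ⟨a, ha, mul_lt_mul_of_pos_left (hfar a ha hx) hx⟩
  have hle : ∑ a ∈ (I.bundle S D j)ᶜ, S.x a j * I.c (S.origin a) j ≤ I.cav S j :=
    Finset.sum_le_sum_of_subset_of_nonneg (Finset.subset_univ _) fun a _ _ =>
      mul_nonneg (hS.feasible.x_nonneg a j) (I.c_nonneg _ _)
  rw [← Finset.sum_mul] at hlt
  nlinarith [hS.cav_nonneg j]

/-! ### Matching -/

variable (I) in
theorem exists_greedyMatching (Q : Finset (Fin n)) : ∃ M, I.GreedyMatching Q M := by
  induction Q using Finset.strongInduction with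
  | H Q ih =>
    rcases le_or_gt Q.card 1 with hQ | hQ
    · exact ⟨[], .done Q hQ⟩
    · have hne : Q.offDiag.Nonempty := by
        obtain ⟨j, hj, j', hj', h⟩ := Finset.one_lt_card.1 hQ
        exact ⟨(j, j'), Finset.mem_offDiag.2 ⟨hj, hj', h⟩⟩
      obtain ⟨p, hp, hmin⟩ := Finset.exists_min_image _ (fun p : Fin n × Fin n => I.cc p.1 p.2) hne
      obtain ⟨hp1, hp2, hp⟩ := Finset.mem_offDiag.1 hp
      obtain ⟨M, hM⟩ := ih ((Q.erase p.1).erase p.2)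
        ((Finset.erase_subset _ _).trans_ssubset (Finset.erase_ssubset hp1))
      exact ⟨_, .step Q M p.1 p.2 hp1 hp2 hp
        (fun i hi i' hi' h => hmin (i, i') (Finset.mem_offDiag.2 ⟨hi, hi', h⟩)) hM⟩

theorem GreedyMatching.mem {Q : Finset (Fin n)} {M : List (Fin n × Fin n)}
    (h : I.GreedyMatching Q M) : ∀ p ∈ M, p.1 ∈ Q ∧ p.2 ∈ Q ∧ p.1 ≠ p.2 := by
  induction h with
  | done => simp
  | step Q M j j' hj hj' hne _ _ ih =>
    intro p hp
    rcases List.mem_cons.1 hp with rfl | hp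
    · exact ⟨hj, hj', hne⟩
    · obtain ⟨h1, h2, h3⟩ := ih p hp
      exact ⟨Finset.mem_of_mem_erase (Finset.mem_of_mem_erase h1),
        Finset.mem_of_mem_erase (Finset.mem_of_mem_erase h2), h3⟩

/-- One of two centers is matched over at most their distance. -/
theorem GreedyMatching.exists_pair {Q : Finset (Fin n)} {M : List (Fin n × Fin n)}
    (h : I.GreedyMatching Q M) {i i' : Fin n} (hi : i ∈ Q) (hi' : i' ∈ Q) (hii' : i ≠ i') :
    ∃ p ∈ M, I.cc p.1 p.2 ≤ I.cc i i' ∧ (p.1 = i ∨ p.1 = i' ∨ p.2 = i ∨ p.2 = i') := by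
  induction h with
  | done Q hQ => exact absurd (Finset.card_le_one.1 hQ i hi i' hi') hii'
  | step Q M j j' hj hj' hne hmin _ ih =>
    -- When the first of `i`, `i'` is matched, both are still available, so the greedy pair is no
    -- longer than their distance.
    by_cases hc : j = i ∨ j = i' ∨ j' = i ∨ j' = i'
    · exact ⟨(j, j'), List.mem_cons_self, hmin i hi i' hi' hii', hc⟩
    · push Not at hc
      obtain ⟨h1, h2, h3, h4⟩ := hc
      obtain ⟨p, hp, hp'⟩ := ih
        (Finset.mem_erase.2 ⟨h3.symm, Finset.mem_erase.2 ⟨h1.symm, hi⟩⟩)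
        (Finset.mem_erase.2 ⟨h4.symm, Finset.mem_erase.2 ⟨h2.symm, hi'⟩⟩)
      exact ⟨p, List.mem_cons_of_mem _ hp, hp'⟩

/-- The centers can be numbered so that matched centers are consecutive. -/
theorem GreedyMatching.exists_numbering {Q : Finset (Fin n)} {M : List (Fin n × Fin n)}
    (h : I.GreedyMatching Q M) :
    ∃ b : Fin n → ℕ, Set.InjOn b Q ∧ ∀ p ∈ M, b p.2 = b p.1 + 1 := by
  induction h with
  | done Q hQ =>
    exact ⟨fun _ => 0, fun i hi i' hi' _ => Finset.card_le_one.1 hQ i hi i' hi', by simp⟩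
  | step Q M j j' hj hj' hne _ hrest ih =>
    obtain ⟨b, hb, hbM⟩ := ih
    -- The new pair takes the numbers 0 and 1; all others are shifted by 2.
    refine ⟨fun i => if i = j then 0 else if i = j' then 1 else b i + 2, ?_, ?_⟩
    · intro i hi i' hi' h
      dsimp only at h
      by_cases h1 : i = j <;> by_cases h2 : i' = j <;> by_cases h3 : i = j' <;>
        by_cases h4 : i' = j' <;> simp only [h1, h2, h3, h4, hne.symm, if_true, if_false] at h <;>
        first
        | omega
        | exact hb (by simpa [h1, h3] using hi) (by simpa [h2, h4] using hi') (by omega)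
    · intro p hp
      rcases List.mem_cons.1 hp with rfl | hp
      · simp [hne.symm]
      · obtain ⟨h1, h2, _⟩ := hrest.mem p hp
        simp only [Finset.mem_erase] at h1 h2
        simp only [h1.1, h1.2.1, h2.1, h2.2.1, if_false, hbM p hp]

/-! ### Sampling -/

theorem exists_isDependentRounding (hS : I.IsCanonical S) {Q D : Finset (Fin n)}
    {M : List (Fin n × Fin n)} (hD : I.ObliviousClustering S Q D) (hM : I.GreedyMatching D M) :
    ∃ μ, I.IsDependentRounding S D M μ := by
  classical
  obtain ⟨b, hb, hbM⟩ := hM.exists_numbering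
  -- Bundles are colored by the numbers of their centers, so matched bundles form a block of two
  -- colors; the remaining copies get a color beyond all of these.
  let color : Fin S.N → ℕ := fun a =>
    if h : ∃ j ∈ D, a ∈ I.bundle S D j then b h.choose else D.sup b + 1
  have hcolor : ∀ j ∈ D, ∀ a, color a = b j ↔ a ∈ I.bundle S D j := by
    intro j hj a
    by_cases h : ∃ j ∈ D, a ∈ I.bundle S D j
    · have e : color a = b h.choose := dif_pos h
      obtain ⟨h1, h2⟩ := h.choose_spec
      rw [e]
      constructor
      · intro he
        rwa [← hb h1 hj he]
      · intro ha
        by_contra hne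
        exact Finset.disjoint_left.1 (bundle_disjoint h1 hj fun he => hne (by rw [he])) h2 ha
    · have e : color a = D.sup b + 1 := dif_neg h
      have h1 : b j ≤ D.sup b := Finset.le_sup hj
      exact ⟨fun he => by omega, fun ha => absurd ⟨j, hj, ha⟩ h⟩
  obtain ⟨μ, h1, h2, h3, h4⟩ := exists_systematic_sampling S.y hS.feasible.y_nonneg
    hS.feasible.y_le_one I.k hS.feasible.opened color
  have hsingle : ∀ j ∈ D, (Finset.univ.filter fun a => b j ≤ color a ∧ color a < b j + 1) =
      I.bundle S D j := by
    intro j hj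
    ext a
    rw [← hcolor j hj a, Finset.mem_filter]
    simp only [Finset.mem_univ, true_and]
    omega
  have hpair : ∀ p ∈ M, (Finset.univ.filter fun a => b p.1 ≤ color a ∧ color a < b p.1 + 2) =
      I.bundle S D p.1 ∪ I.bundle S D p.2 := by
    intro p hp
    obtain ⟨hp1, hp2, _⟩ := hM.mem p hp
    have := hbM p hp
    ext a
    rw [Finset.mem_union, ← hcolor p.1 hp1 a, ← hcolor p.2 hp2 a, Finset.mem_filter]
    simp only [Finset.mem_univ, true_and]
    omega
  refine ⟨μ, h1, fun j hj => ?_, fun A hA p hp => ?_, h2⟩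
  · rw [prob_nonempty_inter]
    · exact Finset.sum_congr rfl fun a _ => h1 a
    · intro A hA
      have := h4 A hA (b j) (b j + 1) (by omega)
      rw [hsingle j hj] at this
      exact this (hS.sum_bundle_le D j)
  · obtain ⟨hp1, hp2, hne⟩ := hM.mem p hp
    have := h3 A hA (b p.1) (b p.1 + 2) (by omega)
    rw [hpair p hp] at this
    refine this ?_
    rw [Finset.sum_union (bundle_disjoint hp1 hp2 hne)]
    have e1 := hS.half_le_sum_bundle (D := D) (j := p.1) fun j' hj' h => hD.separated _ hp1 _ hj' h
    have e2 := hS.half_le_sum_bundle (D := D) (j := p.2) fun j' hj' h => hD.separated _ hp2 _ hj' h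
    linarith

variable (I) in
theorem exists_pad : ∃ pad : Finset (Fin m) → Finset (Fin m),
    ∀ B : Finset (Fin m), B.card ≤ I.k → B ⊆ pad B ∧ (pad B).card = I.k := by
  have h : ∀ B : Finset (Fin m), ∃ B' : Finset (Fin m), B.card ≤ I.k → B ⊆ B' ∧ B'.card = I.k :=
    fun B => by
      by_cases hB : B.card ≤ I.k
      · obtain ⟨B', h1, _, h2⟩ := Finset.exists_subsuperset_card_eq (Finset.subset_univ B) hB
          (by simpa using I.k_le_m)
        exact ⟨B', fun _ => ⟨h1, h2⟩⟩
      · exact ⟨∅, fun h => absurd h hB⟩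
  choose pad hpad using h
  exact ⟨pad, hpad⟩

variable (I) in
theorem exists_isRoundingAlgorithm : ∃ round, I.IsRoundingAlgorithm round := by
  have h : ∀ S : SplitSolution m n, ∃ ν, I.IsCanonical S → I.IsRoundingOutput S ν := fun S => by
    by_cases hS : I.IsCanonical S
    · obtain ⟨D, hD⟩ := I.exists_obliviousClustering S Finset.univ
      obtain ⟨M, hM⟩ := I.exists_greedyMatching D
      obtain ⟨μ, hμ⟩ := exists_isDependentRounding hS hD hM
      obtain ⟨pad, hpad⟩ := I.exists_pad
      exact ⟨_, fun _ => ⟨D, M, μ, pad, hD, hM, hμ, hpad, rfl⟩⟩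
    · exact ⟨PMF.pure ∅, fun h => absurd h hS⟩
  choose round hround using h
  exact ⟨round, hround⟩

end

section

/-! ### The expected cost of a client -/

/-- A bound on the distance to the closest open facility: `d` for a facility in the ball of radius
`R`, and `5 * R` otherwise; increased by `A`, and reduced by `t`. -/
def excess (R A t d : ℝ) : ℝ := max ((if d < R then d else 5 * R) + A - t) 0

theorem excess_monotone {R : ℝ} (hR : 0 < R) (A t : ℝ) : Monotone (excess R A t) := by
  intro d d' h
  refine max_le_max ?_ le_rfl
  split_ifs <;> linarith

theorem excess_le_linear {R A t d : ℝ} (hd : 0 ≤ d) (ht : t ≤ A) :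
    excess R A t d ≤ 5 * d + A - t := by
  refine max_le ?_ (by linarith)
  split_ifs <;> linarith

/-- The slope is that of the line through the origin and the value just after the jump at `R`. Below
`R` a positive excess forces t − A < R, and then the slope is at least 4. -/
theorem excess_le_mul {R A t d : ℝ} (hR : 0 < R) (hd : 0 ≤ d) (ht : A < t) :
    excess R A t d ≤ max (5 - (t - A) / R) 0 * d := by
  have hk := le_max_left (5 - (t - A) / R) 0
  have hk0 := le_max_right (5 - (t - A) / R) 0
  refine max_le ?_ (mul_nonneg hk0 hd)
  split_ifs with h
  · rcases le_or_gt d (t - A) with h1 | h1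
    · have := mul_nonneg hk0 hd
      linarith
    · have h2 : (t - A) / R ≤ 1 := by
        rw [div_le_one hR]
        linarith
      nlinarith
  · have h1 : (5 - (t - A) / R) * R = 5 * R - (t - A) := by
      field_simp
    have h2 : max (5 - (t - A) / R) 0 * R ≤ max (5 - (t - A) / R) 0 * d :=
      mul_le_mul_of_nonneg_left (not_lt.1 h) hk0
    have h3 := mul_le_mul_of_nonneg_right hk hR.le
    linarith

/-- The last hypothesis forces `R` to be large compared with `T` and `C`. Then a copy within `T` of
the client lies inside the ball and causes no excess, and a copy outside the ball is so far from the
client that 9c pays for the fallback distance. -/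
theorem excess_le_nine_mul {R A T C c d : ℝ} (hR : 0 < R) (hT : 0 ≤ T) (hC : 0 ≤ C)
    (hdc : d ≤ c + A) (hA : A ≤ 4 * (T + C)) (hAT : A < 29 * T)
    (hlarge : 9 * C * R < (T + C) * (5 * R - (29 * T - A))) :
    excess R A (29 * T) d ≤ if T < c then 9 * c else 0 := by
  have hCT : 4 * C < 5 * T := by
    have h1 : (T + C) * (5 * R - (29 * T - A)) ≤ (T + C) * (5 * R) :=
      mul_le_mul_of_nonneg_left (by linarith) (by linarith)
    have h2 : (4 * C) * R < (5 * T) * R := by linarith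
    exact lt_of_mul_lt_mul_right h2 hR.le
  have hR1 : (T + C) * (25 * T - 4 * C) < R * (5 * T - 4 * C) := by
    have h1 : (T + C) * (5 * R - (29 * T - A)) ≤ (T + C) * (5 * R - 25 * T + 4 * C) :=
      mul_le_mul_of_nonneg_left (by linarith) (by linarith)
    linarith
  -- A copy with c ≤ T has d ≤ T + A ≤ 5T + 4C. For C = 0 this needs exactly the 25 = 29 − 4 of the
  -- previous bound.
  have hR2 : 5 * T + 4 * C < R := by
    refine lt_of_mul_lt_mul_right (a := 5 * T - 4 * C) ?_ (by linarith)
    nlinarith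
  -- Outside the ball c ≥ R − A; since 10A ≤ 40(T + C), this is what gives 5R + A − 29T ≤ 9(R − A).
  have hR3 : 11 * T + 40 * C ≤ 4 * R := by
    refine le_of_mul_le_mul_right (a := 5 * T - 4 * C) ?_ (by linarith)
    nlinarith [sq_nonneg (T - C), sq_nonneg (T - 2 * C)]
  refine max_le ?_ (by split_ifs <;> linarith)
  split_ifs with h1 h2 h2
  · linarith
  · linarith
  · linarith
  · linarith

/-- Here `x`, `c` belong to the client, `x'`, `d` to its center, and u is the average cost of the
client. Since u ≤ T + C, with C the part beyond the threshold, the first two cases use only the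
averages. The third is pointwise and needs the transport hypothesis, that `x'` is a nearest
assignment for the center. -/
theorem sum_excess_le {ι : Type*} [Fintype ι] (x x' c d : ι → ℝ) (e : ι → Prop) [DecidablePred e]
    {A R T u : ℝ} (hR : 0 < R) (hT : 0 ≤ T) (hA0 : 0 ≤ A) (hA : A ≤ 4 * u)
    (hx0 : ∀ a, 0 ≤ x a) (hx : ∑ a, x a = 1) (hx0' : ∀ a, 0 ≤ x' a) (hx' : ∑ a, x' a = 1)
    (hc : ∀ a, 0 ≤ c a) (hd : ∀ a, 0 ≤ d a) (hdc : ∀ a, d a ≤ c a + A)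
    (he : ∀ a, ¬ e a → c a ≤ T) (hu : ∑ a, x a * c a = u) (hu' : ∑ a, x' a * d a ≤ u)
    (htransport : ∀ f : ℝ → ℝ, Monotone f → ∑ a, f (d a) * x' a ≤ ∑ a, f (d a) * x a) :
    ∑ a, excess R A (29 * T) (d a) * x' a ≤ 9 * ∑ a, if e a then x a * c a else 0 := by
  set C := ∑ a, if e a then x a * c a else 0 with hCdef
  have hC : 0 ≤ C := Finset.sum_nonneg fun a _ => by
    split_ifs
    · exact mul_nonneg (hx0 a) (hc a)
    · exact le_rfl
  have huC : u ≤ T + C := by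
    have : ∑ a, x a * c a ≤ ∑ a, (T * x a + if e a then x a * c a else 0) := by
      refine Finset.sum_le_sum fun a _ => ?_
      split_ifs with h
      · linarith [mul_nonneg hT (hx0 a)]
      · rw [add_zero, mul_comm]
        exact mul_le_mul_of_nonneg_right (he a h) (hx0 a)
    rw [Finset.sum_add_distrib, ← Finset.mul_sum, hx] at this
    linarith
  -- If A ≥ 29T, the linear bound gives 5u + A − 29T ≤ 9u − 29T ≤ 9C.
  rcases le_or_gt (29 * T) A with hAT | hAT
  · have h1 : ∑ a, excess R A (29 * T) (d a) * x' a ≤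
        ∑ a, (5 * (x' a * d a) + (A - 29 * T) * x' a) := by
      refine Finset.sum_le_sum fun a _ => ?_
      have := mul_le_mul_of_nonneg_right (excess_le_linear (R := R) (hd a) hAT) (hx0' a)
      linarith
    rw [Finset.sum_add_distrib, ← Finset.mul_sum, ← Finset.mul_sum, hx'] at h1
    linarith
  -- The dividing line is whether the multiplicative bound, applied to u ≤ T + C, already yields 9C.
  rcases le_or_gt ((T + C) * (5 * R - (29 * T - A))) (9 * C * R) with hsmall | hlarge
  · set κ := max (5 - (29 * T - A) / R) 0 with hκ
    have h1 : ∑ a, excess R A (29 * T) (d a) * x' a ≤ ∑ a, κ * (x' a * d a) := by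
      refine Finset.sum_le_sum fun a _ => ?_
      have := mul_le_mul_of_nonneg_right (excess_le_mul hR (hd a) hAT) (hx0' a)
      linarith
    rw [← Finset.mul_sum] at h1
    have h2 : κ * ∑ a, x' a * d a ≤ κ * (T + C) :=
      mul_le_mul_of_nonneg_left (hu'.trans huC) (le_max_right _ _)
    have h3 : κ * (T + C) ≤ 9 * C := by
      rw [hκ, max_mul_of_nonneg _ _ (by linarith)]
      refine max_le (le_of_mul_le_mul_right ?_ hR) (by linarith)
      have : (5 - (29 * T - A) / R) * (T + C) * R = (T + C) * (5 * R - (29 * T - A)) := by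
        field_simp
      linarith
    linarith
  · refine (htransport _ (excess_monotone hR A _)).trans ?_
    rw [hCdef, Finset.mul_sum]
    refine Finset.sum_le_sum fun a _ => ?_
    have h1 := mul_le_mul_of_nonneg_right (excess_le_nine_mul hR hT hC (hdc a)
      (by linarith) hAT hlarge) (hx0 a)
    refine h1.trans ?_
    split_ifs with h2 h3 h3
    · linarith
    · exact absurd h2 (he a h3).not_gt
    · simpa using mul_nonneg (hx0 a) (hc a)
    · simp

/-- Needed for a single center: its bundle has mass one, and the bundle is then hit surely. -/
theorem of_prob_eq_one {α : Type*} [Fintype α] {μ : PMF α} {P : α → Prop} (h : prob μ P = 1)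
    {a : α} (ha : a ∈ μ.support) : P a := by
  classical
  by_contra hP
  have h1 : expect μ (fun b => (if P b then 1 else 0) + if b = a then 1 else 0) ≤ 1 := by
    refine (expect_mono μ fun b _ => ?_).trans (expect_const μ 1).le
    by_cases hb : b = a
    · subst hb
      simp [hP]
    · simp only [hb, if_false, add_zero]
      split_ifs <;> norm_num
  rw [expect_add] at h1
  have h2 : expect μ (fun b => if P b then (1 : ℝ) else 0) = 1 := by
    rw [← h, prob]
    exact congrArg _ (funext fun b => by congr)
  have h3 : expect μ (fun b => if b = a then (1 : ℝ) else 0) = (μ a).toReal := by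
    simp [expect]
  have h4 : 0 < (μ a).toReal :=
    ENNReal.toReal_pos ((PMF.mem_support_iff _ _).1 ha) (μ.apply_ne_top a)
  linarith

variable {X : Type*} [PseudoMetricSpace X] {m n : ℕ} {I : OrderedKMedian X m n}
  {S : SplitSolution m n}

/-- Around each center there is a ball such that the copies in the ball that serve the center form its
bundle, and some copy is open within five times the radius. -/
theorem IsDependentRounding.exists_radius (hS : I.IsCanonical S) {D : Finset (Fin n)}
    {M : List (Fin n × Fin n)} {μ : PMF (Finset (Fin S.N))} (hM : I.GreedyMatching D M)
    (hμ : I.IsDependentRounding S D M μ) {j : Fin n} (hj : j ∈ D)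
    (hsep : ∀ j' ∈ D, j ≠ j' → 0 < I.cc j j') :
    ∃ R : ℝ, 0 < R ∧
      (∀ a, a ∈ I.bundle S D j ↔ I.c (S.origin a) j < R ∧ 0 < S.x a j) ∧
      ∀ A ∈ μ.support, ∃ a ∈ A, I.c (S.origin a) j ≤ 5 * R := by
  rcases (D.erase j).eq_empty_or_nonempty with hD | hD
  · set R := 1 + ∑ a, I.c (S.origin a) j with hRdef
    have hlt : ∀ a, I.c (S.origin a) j < R := fun a => by
      have := Finset.single_le_sum (f := fun a => I.c (S.origin a) j)
        (fun a _ => I.c_nonneg _ _) (Finset.mem_univ a)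
      linarith
    have hR : 0 < R := by
      have : 0 ≤ ∑ a, I.c (S.origin a) j := Finset.sum_nonneg fun a _ => I.c_nonneg _ _
      linarith
    have hmem : ∀ a, a ∈ I.bundle S D j ↔ 0 < S.x a j := fun a => by
      rw [mem_bundle, and_iff_right]
      intro j' hj' hne
      exact absurd (Finset.mem_erase.2 ⟨hne, hj'⟩) (by simp [hD])
    refine ⟨R, hR, fun a => by rw [hmem, and_iff_right (hlt a)], fun A hA => ?_⟩
    have h1 : prob μ (fun A => (A ∩ I.bundle S D j).Nonempty) = 1 := by
      rw [hμ.bundle_prob j hj]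
      have h2 := hS.one_sub_sum_bundle D j
      have h3 : ∑ a ∈ (I.bundle S D j)ᶜ, S.x a j = 0 := Finset.sum_eq_zero fun a ha => by
        rw [Finset.mem_compl, hmem] at ha
        exact le_antisymm (not_lt.1 ha) (hS.feasible.x_nonneg a j)
      linarith
    obtain ⟨a, ha⟩ := of_prob_eq_one h1 hA
    exact ⟨a, (Finset.mem_inter.1 ha).1, by linarith [hlt a]⟩
  · obtain ⟨i, hi, hmin⟩ := Finset.exists_min_image _ (I.cc j) hD
    obtain ⟨hne, hiD⟩ := Finset.mem_erase.1 hi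
    refine ⟨I.cc j i / 2, by linarith [hsep i hiD hne.symm], fun a => ?_, fun A hA => ?_⟩
    · rw [mem_bundle]
      refine and_congr_left fun _ => ⟨fun h => h i hiD hne, fun h j' hj' hne' => ?_⟩
      have := hmin j' (Finset.mem_erase.2 ⟨hne', hj'⟩)
      linarith
    · obtain ⟨p, hp, hle, htouch⟩ := hM.exists_pair hj hiD hne.symm
      obtain ⟨hp1, hp2, hp12⟩ := hM.mem p hp
      obtain ⟨a, ha⟩ := hμ.pair_opened A hA p hp
      obtain ⟨haA, ha⟩ := Finset.mem_inter.1 ha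
      refine ⟨a, haA, ?_⟩
      have hcomm := I.cc_comm p.1 p.2
      have hnn := I.cc_nonneg p.1 p.2
      -- Half the pair's distance inside a bundle, plus possibly the pair's distance. As that
      -- distance is at most 2R, this is 3R; moving from the nearest center `i` to `j` costs another
      -- 2R, hence 5R.
      have hpq : I.c (S.origin a) p.1 ≤ 3 / 2 * I.cc p.1 p.2 ∧
          I.c (S.origin a) p.2 ≤ 3 / 2 * I.cc p.1 p.2 := by
        rcases Finset.mem_union.1 ha with ha | ha
        · have h1 := (mem_bundle.1 ha).1 p.2 hp2 hp12.symm
          have h2 := I.c_triangle (S.origin a) p.1 p.2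
          constructor <;> linarith
        · have h1 := (mem_bundle.1 ha).1 p.1 hp1 hp12
          have h2 := I.c_triangle (S.origin a) p.2 p.1
          constructor <;> linarith
      have hji : ∀ q, q = j ∨ q = i → I.c (S.origin a) q ≤ 3 / 2 * I.cc p.1 p.2 →
          I.c (S.origin a) j ≤ 5 * (I.cc j i / 2) := by
        intro q hq h
        rcases hq with rfl | rfl
        · linarith [I.cc_nonneg q i]
        · have := I.c_triangle (S.origin a) q j
          rw [cc_comm] at this
          linarith
      rcases htouch with h | h | h | h
      · exact hji _ (Or.inl h) hpq.1
      · exact hji _ (Or.inr h) hpq.1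
      · exact hji _ (Or.inl h) hpq.2
      · exact hji _ (Or.inr h) hpq.2

/-- Pointwise, the cost beyond t is at most the sum of the excesses of open bundle copies, plus the
fallback value if the bundle is missed. The miss probability is exactly the mass serving the center
from outside the bundle, where the excess equals the fallback value. -/
theorem IsDependentRounding.expect_excess_le (hS : I.IsCanonical S) {D : Finset (Fin n)}
    {M : List (Fin n × Fin n)} {μ : PMF (Finset (Fin S.N))}
    (hμ : I.IsDependentRounding S D M μ) {pad : Finset (Fin m) → Finset (Fin m)}
    (hpad : ∀ B : Finset (Fin m), B.card ≤ I.k → B ⊆ pad B) {j j' : Fin n} (hj' : j' ∈ D) {R : ℝ}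
    (hbundle : ∀ a, a ∈ I.bundle S D j' ↔ I.c (S.origin a) j' < R ∧ 0 < S.x a j')
    (hfall : ∀ A ∈ μ.support, ∃ a ∈ A, I.c (S.origin a) j' ≤ 5 * R) (t : ℝ) :
    expect μ (fun A => max (I.connCost (pad (A.image S.origin)) j - t) 0) ≤
      ∑ a, excess R (I.cc j' j) t (I.c (S.origin a) j') * S.x a j' := by
  classical
  set B := I.bundle S D j' with hB
  set F : Fin S.N → ℝ := fun a => excess R (I.cc j' j) t (I.c (S.origin a) j') with hF
  set F' : ℝ := max (5 * R + I.cc j' j - t) 0 with hF'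
  have hF0 : ∀ a, 0 ≤ F a := fun a => le_max_right _ _
  have hconn : ∀ A ∈ μ.support, ∀ a ∈ A,
      I.connCost (pad (A.image S.origin)) j ≤ I.c (S.origin a) j' + I.cc j' j :=
    fun A hA a ha => (connCost_le (hpad _ (Finset.card_image_le.trans (hμ.card_le A hA))
      (Finset.mem_image_of_mem _ ha)) j).trans (c_triangle _ _ _)
  have hpoint : ∀ A ∈ μ.support, max (I.connCost (pad (A.image S.origin)) j - t) 0 ≤
      ∑ a ∈ B, F a * (if a ∈ A then 1 else 0) +
        (F' + -F' * if (A ∩ B).Nonempty then 1 else 0) := by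
    intro A hA
    have hnn : ∀ a ∈ B, 0 ≤ F a * (if a ∈ A then 1 else 0) := fun a _ => by
      have := hF0 a
      split_ifs <;> simp [this]
    by_cases hne : (A ∩ B).Nonempty
    · obtain ⟨a, ha⟩ := id hne
      obtain ⟨haA, haB⟩ := Finset.mem_inter.1 ha
      have h1 := Finset.single_le_sum hnn haB
      rw [if_pos haA, mul_one] at h1
      rw [if_pos hne]
      have h2 : max (I.connCost (pad (A.image S.origin)) j - t) 0 ≤ F a := by
        refine max_le_max ?_ le_rfl
        rw [if_pos ((hbundle a).1 haB).1]
        linarith [hconn A hA a haA]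
      linarith
    · rw [if_neg hne]
      obtain ⟨a, haA, ha⟩ := hfall A hA
      have h2 : max (I.connCost (pad (A.image S.origin)) j - t) 0 ≤ F' :=
        max_le_max (by linarith [hconn A hA a haA]) le_rfl
      have := Finset.sum_nonneg hnn
      linarith
  refine (expect_mono μ hpoint).trans (le_of_eq ?_)
  have hp1 : ∀ a, expect μ (fun A => if a ∈ A then (1 : ℝ) else 0) = S.y a := fun a => by
    rw [← hμ.facility_prob a, prob]
    exact congrArg _ (funext fun A => by congr)
  have hp2 : expect μ (fun A => if (A ∩ B).Nonempty then (1 : ℝ) else 0) = ∑ a ∈ B, S.y a := by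
    rw [← hμ.bundle_prob j' hj', prob]
    exact congrArg _ (funext fun A => by congr)
  rw [expect_add, expect_add, expect_sum, expect_const, expect_mul_left, hp2]
  simp only [expect_mul_left, hp1]
  have h1 : F' + -F' * ∑ a ∈ B, S.y a = F' * ∑ a ∈ Bᶜ, S.x a j' := by
    rw [← hS.one_sub_sum_bundle D j']
    ring
  rw [h1, Finset.mul_sum, ← Finset.sum_add_sum_compl B]
  congr 1
  · exact Finset.sum_congr rfl fun a ha => by rw [hS.x_eq_y ((hbundle a).1 ha).2]
  · refine Finset.sum_congr rfl fun a ha => ?_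
    rcases (hS.feasible.x_nonneg a j').lt_or_eq with hx | hx
    · have h2 : ¬ I.c (S.origin a) j' < R := fun hc =>
        Finset.mem_compl.1 ha ((hbundle a).2 ⟨hc, hx⟩)
      simp only [excess, if_neg h2, hF']
    · simp [← hx]

/-- The expected connection cost of a client beyond `29 * T` is at most nine times the contribution of
the pairs at distance more than `T` to its average cost. -/
theorem IsRoundingOutput.expect_connCost_le (hS : I.IsCanonical S) {ν : PMF (Finset (Fin m))}
    (hν : I.IsRoundingOutput S ν) (j : Fin n) {T : ℝ} (hT : 0 ≤ T) (e : Fin S.N → Prop)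
    [DecidablePred e] (he : ∀ a, ¬ e a → I.c (S.origin a) j ≤ T) :
    expect ν (fun A => max (I.connCost A j - 29 * T) 0) ≤
      9 * ∑ a, if e a then S.x a j * I.c (S.origin a) j else 0 := by
  obtain ⟨D, M, μ, pad, hD, hM, hμ, hpad, rfl⟩ := hν
  obtain ⟨j', hj', hclose, hcav⟩ := hD.covered hS.cav_nonneg j (Finset.mem_univ j)
  obtain ⟨R, hR, hbundle, hfall⟩ := hμ.exists_radius hS hM hj' fun i hi hne =>
    lt_of_le_of_lt (by linarith [hS.cav_nonneg j']) (hD.separated j' hj' i hi hne)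
  rw [expect_map]
  refine (hμ.expect_excess_le hS (fun B hB => (hpad B hB).1) hj' hbundle hfall (29 * T)).trans ?_
  have hf := hS.feasible
  refine sum_excess_le (fun a => S.x a j) (fun a => S.x a j') (fun a => I.c (S.origin a) j)
    (fun a => I.c (S.origin a) j') e hR hT (cc_nonneg _ _) hclose (fun a => hf.x_nonneg a j)
    (hf.served j) (fun a => hf.x_nonneg a j') (hf.served j') (fun a => I.c_nonneg _ _)
    (fun a => I.c_nonneg _ _) (fun a => ?_) he rfl hcav fun f hmono => ?_
  · rw [cc_comm]
    exact c_triangle _ _ _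
  -- Distance-optimality of the center's assignment makes it minimal for every monotone function of
  -- the distance to the center.
  · exact sum_mul_le_of_exchange (fun a => f (I.c (S.origin a) j')) (fun a => S.x a j')
      (fun a => S.x a j) S.y (hf.served j') (hf.served j) (fun a => hf.x_le_y a j')
      (fun a => hf.x_nonneg a j) (fun a => hf.x_le_y a j)
      fun a b ha hb => hmono (hf.exchange hS.distance_optimal ha hb)

theorem IsRoundingOutput.expect_cost_le {rank : Fin m × Fin n → ℕ} (hrank : I.IsRanking rank)
    {W : Finset (Fin m)} (hW : W.card = I.k) {g : I.Guess} (hg : I.IsRightGuess rank W g)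
    (hS : I.IsCanonical S) (hopt : I.LPOptimal (I.reducedCost rank g) S.totalX S.totalY)
    {ν : PMF (Finset (Fin m))} (hν : I.IsRoundingOutput S ν) :
    expect ν I.cost ≤ 38 * I.cost W := by
  obtain ⟨δ, hδ⟩ := I.exists_isDecrement
  have h1 := hg.sum_threshold_le hrank hδ
  have h2 := hg.lpValue_le hrank hW hopt
  rw [lpValue_reducedCost_eq hδ hg.isDecreasing] at h2
  refine (expect_mono ν fun A _ => cost_le_sum_levels hδ A
    fun r => 29 * I.c (g r).1 (g r).2).trans ?_
  simp only [expect_sum, expect_mul_left, expect_add, expect_const]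
  have h3 : ∀ r, δ r * (∑ s, (if I.wbar r ≤ I.w s then 29 * I.c (g r).1 (g r).2 else 0) +
      ∑ j, expect ν fun A => max (I.connCost A j - 29 * I.c (g r).1 (g r).2) 0) ≤
      29 * (δ r * ∑ s, if I.wbar r ≤ I.w s then I.c (g r).1 (g r).2 else 0) +
      9 * (δ r * ∑ j, ∑ a, if rank (g r) ≤ rank (S.origin a, j) then
        S.x a j * I.c (S.origin a) j else 0) := by
    intro r
    have h4 : ∑ s, (if I.wbar r ≤ I.w s then 29 * I.c (g r).1 (g r).2 else 0) =
        29 * ∑ s, if I.wbar r ≤ I.w s then I.c (g r).1 (g r).2 else 0 := by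
      rw [Finset.mul_sum]
      exact Finset.sum_congr rfl fun s _ => by split_ifs <;> simp
    have h5 : (∑ j, expect ν fun A => max (I.connCost A j - 29 * I.c (g r).1 (g r).2) 0) ≤
        9 * ∑ j, ∑ a, if rank (g r) ≤ rank (S.origin a, j) then
          S.x a j * I.c (S.origin a) j else 0 := by
      rw [Finset.mul_sum]
      exact Finset.sum_le_sum fun j _ => hν.expect_connCost_le hS j (I.c_nonneg _ _)
        (fun a => rank (g r) ≤ rank (S.origin a, j))
        fun a ha => hrank.c_le (p := (S.origin a, j)) (not_le.1 ha).le
    rw [h4]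
    have := mul_le_mul_of_nonneg_left h5 (hδ.1 r)
    linarith
  refine (Finset.sum_le_sum fun r _ => h3 r).trans ?_
  rw [Finset.sum_add_distrib, ← Finset.mul_sum, ← Finset.mul_sum]
  linarith

theorem IsRoundingOutput.card_eq {ν : PMF (Finset (Fin m))} (hν : I.IsRoundingOutput S ν)
    {A : Finset (Fin m)} (hA : A ∈ ν.support) : A.card = I.k := by
  obtain ⟨D, M, μ, pad, _, _, hμ, hpad, rfl⟩ := hν
  obtain ⟨B, hB, rfl⟩ := (PMF.mem_support_map_iff _ _ _).1 hA
  exact (hpad _ (Finset.card_image_le.trans (hμ.card_le B hB))).2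

/-! ### The search over the guesses -/

section Search

variable {solve : I.Guess → SplitSolution m n} {round : SplitSolution m n → PMF (Finset (Fin m))}

theorem mem_support_search {gs : List I.Guess}
    (hround : ∀ g ∈ gs, ∀ A ∈ (round (solve g)).support, A.card = I.k)
    {s : Option (Finset (Fin m)) × ℕ} (hs : s ∈ (I.search solve round gs).support) :
    s.2 = gs.length ∧ (gs ≠ [] → s.1 ≠ none) ∧ ∀ W, s.1 = some W → W.card = I.k := by
  induction gs generalizing s with
  | nil =>
    rw [search, PMF.mem_support_pure_iff] at hs
    simp [hs]
  | cons g gs ih =>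
    rw [search, PMF.mem_support_bind_iff] at hs
    obtain ⟨A, hA, hs⟩ := hs
    obtain ⟨s', hs', rfl⟩ := (PMF.mem_support_map_iff _ _ _).1 hs
    obtain ⟨h1, _, h3⟩ := ih (fun g' hg' => hround g' (List.mem_cons_of_mem _ hg')) hs'
    refine ⟨by simp [h1], by simp, ?_⟩
    rintro W hW
    obtain rfl : I.cheaper A s'.1 = W := by simpa using hW
    have hAk := hround g List.mem_cons_self A hA
    rcases hB : s'.1 with _ | B
    · exact hAk
    · simp only [cheaper]
      split_ifs
      · exact hAk
      · exact h3 B hB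

theorem cost_cheaper_le_left (A : Finset (Fin m)) (o : Option (Finset (Fin m))) :
    I.cost (I.cheaper A o) ≤ I.cost A := by
  rcases o with _ | B
  · exact le_rfl
  · simp only [cheaper]
    split_ifs with h
    · exact le_rfl
    · exact (not_le.1 h).le

theorem cost_cheaper_le_right (A B : Finset (Fin m)) :
    I.cost (I.cheaper A (some B)) ≤ I.cost B := by
  simp only [cheaper]
  split_ifs with h
  · exact h
  · exact le_rfl

/-- `expect` requires a finite type, so the counter of calls is projected away. -/
theorem map_fst_search_cons (g : I.Guess) (gs : List I.Guess) :
    (I.search solve round (g :: gs)).map Prod.fst = (round (solve g)).bind fun A =>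
      ((I.search solve round gs).map Prod.fst).map fun o => some (I.cheaper A o) := by
  rw [search, PMF.map_bind]
  congr 1
  funext A
  rw [PMF.map_comp, PMF.map_comp]
  rfl

/-- The solution kept is never more expensive than the one found for g, whatever the other calls
return. -/
theorem expect_search_le {gs : List I.Guess}
    (hround : ∀ g ∈ gs, ∀ A ∈ (round (solve g)).support, A.card = I.k) {g : I.Guess}
    (hg : g ∈ gs) :
    expect ((I.search solve round gs).map Prod.fst) (fun o => o.elim 0 I.cost) ≤
      expect (round (solve g)) I.cost := by
  induction gs with
  | nil => simp at hg
  | cons g' gs ih =>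
    have hround' := fun g'' hg'' => hround g'' (List.mem_cons_of_mem g' hg'')
    rw [map_fst_search_cons, expect_bind]
    simp only [expect_map _ _ fun o : Option (Finset (Fin m)) => o.elim 0 I.cost, Option.elim_some]
    by_cases hgs : g ∈ gs
    · refine le_trans ?_ (ih hround' hgs)
      refine (expect_mono _ fun A _ => ?_).trans (expect_const (round (solve g')) _).le
      refine expect_mono _ fun o ho => ?_
      obtain ⟨s, hs, rfl⟩ := (PMF.mem_support_map_iff _ _ _).1 ho
      rcases hB : s.1 with _ | B
      -- The value 0 assigned to `none` would break the bound; it cannot occur because the rest of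
      -- the list contains g.
      · exact absurd hB ((mem_support_search hround' hs).2.1 (List.ne_nil_of_mem hgs))
      · exact cost_cheaper_le_right A B
    · obtain rfl : g = g' := (List.mem_cons.1 hg).resolve_right hgs
      refine expect_mono _ fun A _ => ?_
      exact (expect_mono _ fun o _ => cost_cheaper_le_left A o).trans (expect_const _ _).le

end Search

end

end OrderedKMedian

end

theorem mainTheorem4 {X : Type*} [PseudoMetricSpace X] {m n : ℕ} (I : OrderedKMedian X m n)
    (rank : Fin m × Fin n → ℕ) (hrank : I.IsRanking rank) :
    -- the algorithm can be implemented
    (∃ solve, I.IsLPSolver rank solve) ∧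
    (∃ round, I.IsRoundingAlgorithm round) ∧
    -- every optimum solution has a right guess
    (∀ W, I.IsOptimum W → ∃ g, I.IsRightGuess rank W g) ∧
    ∀ (solve : I.Guess → SplitSolution m n) (round : SplitSolution m n → PMF (Finset (Fin m))),
      I.IsLPSolver rank solve → I.IsRoundingAlgorithm round →
      -- a right guess alone gives a 38-approximation in expectation
      (∀ W g, I.IsOptimum W → I.IsRightGuess rank W g →
        I.IsDecreasing rank g ∧
        OrderedKMedian.expect (round (solve g)) I.cost ≤ 38 * I.opt) ∧
      -- the algorithm always returns `k` facilities, after at most `(nm)^R` calls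
      (∀ s ∈ (I.algorithm rank solve round).support,
        (∃ W : Finset (Fin m), s.1 = some W ∧ W.card = I.k) ∧ s.2 ≤ (n * m) ^ I.R) ∧
      -- its expected cost is at most 38 times the optimum
      OrderedKMedian.expect ((I.algorithm rank solve round).map Prod.fst)
        (fun o => o.elim 0 I.cost) ≤ 38 * I.opt := by
  classical
  refine ⟨I.exists_isLPSolver hrank, I.exists_isRoundingAlgorithm,
    fun W hW => OrderedKMedian.exists_isRightGuess hrank
      (OrderedKMedian.nonempty_of_card_eq hW.1), fun solve round hsolve hround => ?_⟩
  have hright : ∀ W g, I.IsOptimum W → I.IsRightGuess rank W g →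
      I.IsDecreasing rank g ∧
        OrderedKMedian.expect (round (solve g)) I.cost ≤ 38 * I.opt := fun W g hW hg => by
    obtain ⟨hcan, hopt⟩ := hsolve g hg.isDecreasing
    refine ⟨hg.isDecreasing, ?_⟩
    rw [← hW.cost_eq]
    exact (hround _ hcan).expect_cost_le hrank hW.1 hg hcan hopt
  -- A right guess for some optimum has decreasing thresholds, so it is tried; this also makes the
  -- list of guesses nonempty.
  obtain ⟨W, hW⟩ := I.exists_isOptimum
  obtain ⟨g, hg⟩ := OrderedKMedian.exists_isRightGuess hrank
    (OrderedKMedian.nonempty_of_card_eq hW.1)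
  have hcard : ∀ g ∈ ((Finset.univ : Finset I.Guess).filter fun g =>
      I.IsDecreasing rank g).toList, ∀ A ∈ (round (solve g)).support, A.card = I.k :=
    fun g hg A hA => by
      have hdec : I.IsDecreasing rank g := by simpa using hg
      exact (hround _ (hsolve g hdec).1).card_eq hA
  have hmem : g ∈ ((Finset.univ : Finset I.Guess).filter fun g =>
      I.IsDecreasing rank g).toList := by simpa using hg.isDecreasing
  have halg : I.algorithm rank solve round = I.search solve round
      ((Finset.univ : Finset I.Guess).filter fun g => I.IsDecreasing rank g).toList := by
    rw [OrderedKMedian.algorithm]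
  rw [halg]
  refine ⟨hright, fun s hs => ?_, (OrderedKMedian.expect_search_le hcard hmem).trans
    (hright W g hW hg).2⟩
  obtain ⟨h1, h2, h3⟩ := OrderedKMedian.mem_support_search hcard hs
  obtain ⟨A, hA⟩ := Option.ne_none_iff_exists'.1 (h2 (List.ne_nil_of_mem hmem))
  refine ⟨⟨A, hA, h3 A hA⟩, ?_⟩
  rw [h1, Finset.length_toList]
  refine (Finset.card_le_univ _).trans (le_of_eq ?_)
  simp [mul_comm]
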